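/- Let $p$ be a prime number and let $f:X\to Y$ be a finite surjective morphism of integral normal locally Noetherian $\mathbb F_p$-schemes (for example, of integral normal excellent $\mathbb F_p$-schemes). Assume that the induced extension of function fields $K(Y)\subset K(X)$ is Galois and that the order of its Galois group $G$ is not divisible by $p$. Let $D$ be an $\mathbb R$-divisor on $Y$, i.e. a locally finite sum of prime divisors with real coefficients. Notation. The pullback $f^*D$ is the $\mathbb R$-divisor on $X$ whose coefficient at a point $x$ of codimension one is $e_x$ times the coefficient of $D$ at $f(x)$ (again a point of codimension one), where $e_x$ is the ramification index of $\mathcal O_{Y,f(x)}\to\mathcal O_{X,x}$; thus $f^*\mathrm{div}(\psi)=\mathrm{div}(f^*\psi)$ for $\psi\in K(Y)^\times$. For an $\mathbb R$-divisor $E$ on an integral normal locally Noetherian $\mathbb F_p$-scheme $Z$, $W\mathcal O_Z(E)$ is the sub-$W\mathcal O_Z$-module of the constant sheaf $W(K(Z))$ whose sections over a non-empty open set $U$ are the Witt vectors $(\varphi_0,\varphi_1,\dots)\in W(K(Z))$ such that, for every $m\ge 0$, either $\varphi_m=0$ or $(\mathrm{div}(\varphi_m)+p^mE)|_U\ge 0$.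 For $n\ge1$, $W_n\mathcal O_Z(E)$ is the sub-$W_n\mathcal O_Z$-module of the constant sheaf $W_n(K(Z))$ defined by the same conditions on $(\varphi_0,\dots,\varphi_{n-1})$. The ring homomorphisms $W_n(K(Y))\to W_n(K(X))$ and $W(K(Y))\to W(K(X))$ induce the pullback homomorphisms below. Then the following hold. (1) For every integer $n\ge 1$, the homomorphism of $W_n\mathcal O_Y$-modules $W_n\mathcal O_Y(D)\to f_*\bigl(W_n\mathcal O_X(f^*D)\bigr)$ splits, that is, it has a $W_n\mathcal O_Y$-linear left inverse. (2) The homomorphism of $W\mathcal O_Y$-modules $W\mathcal O_Y(D)\to f_*\bigl(W\mathcal O_X(f^*D)\bigr)$ splits, that is, it has a $W\mathcal O_Y$-linear left inverse. Moreover, in both cases the left inverse can be taken to be the Galois average $$\varphi\longmapsto \frac1{|G|}\sum_{\sigma\in G}\sigma(\varphi),$$ where $\sigma\in G$ acts on $W_n(K(X))$, resp. $W(K(X))$, componentwise, and $G$-invariant Witt vectors over $K(X)$ are identified with Witt vectors over $K(Y)$. -/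

import Mathlib

universe u

namespace WittDiv

noncomputable section

open CategoryTheory TopologicalSpace Opposite AlgebraicGeometry

section WittAlgebra

variable (p : ℕ) [hp : Fact p.Prime]

/-- Multiplication by a Teichmueller representative: `([t] x)_n = t ^ (p ^ n) x_n`. -/
theorem teichmuller_mul_coeff {R : Type u} [CommRing R] (t : R) (x : WittVector p R) (n : ℕ) :
    (WittVector.teichmuller p t * x).coeff n = t ^ p ^ n * x.coeff n := by
  have key : ∀ {A : Type u} [CommRing A] [Invertible (p : A)] (t : A) (x : WittVector p A),
      WittVector.teichmuller p t * x = WittVector.mk p (fun n => t ^ p ^ n * x.coeff n) := by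
    intro A _ _ t x
    apply (WittVector.ghostMap.bijective_of_invertible p A).1
    rw [map_mul]
    ext1 n
    rw [Pi.mul_apply, WittVector.ghostMap_apply, WittVector.ghostMap_apply,
      WittVector.ghostMap_apply, WittVector.ghostComponent_teichmuller]
    rw [WittVector.ghostComponent_apply, WittVector.ghostComponent_apply, aeval_wittPolynomial,
      aeval_wittPolynomial, Finset.mul_sum]
    refine Finset.sum_congr rfl fun i hi => ?_
    have hi' : i ≤ n := Nat.lt_succ_iff.mp (Finset.mem_range.mp hi)
    rw [WittVector.coeff_mk, mul_pow, ← pow_mul, ← pow_add, Nat.add_sub_cancel' hi']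
    ring
  have key2 : ∀ (t : MvPolynomial R ℤ) (x : WittVector p (MvPolynomial R ℤ)),
      WittVector.teichmuller p t * x = WittVector.mk p (fun n => t ^ p ^ n * x.coeff n) := by
    intro t x
    refine WittVector.map_injective (MvPolynomial.map (Int.castRingHom ℚ))
      (MvPolynomial.map_injective _ Int.cast_injective) ?_
    rw [map_mul, WittVector.map_teichmuller, key]
    ext n
    simp [WittVector.map_coeff]
  obtain ⟨t, rfl⟩ := MvPolynomial.counit_surjective R t
  obtain ⟨x, rfl⟩ := WittVector.map_surjective (MvPolynomial.counit R : _ →+* R)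
    (MvPolynomial.counit_surjective R) x
  rw [← WittVector.map_teichmuller, ← map_mul, key2]
  simp [WittVector.map_coeff]

/-- A filtration `C 0, C 1, ...` of a ring by subgroups with `C a * C b ⊆ C (a + b)`. -/
structure MulFiltration (K : Type*) [CommRing K] where
  C : ℕ → AddSubgroup K
  one_mem : (1 : K) ∈ C 0
  mul_mem_add : ∀ {a b : ℕ} {x y : K}, x ∈ C a → y ∈ C b → x * y ∈ C (a + b)

variable {K : Type*} [CommRing K] (F : MulFiltration K)

/-- The Rees subring of `K[X]`: polynomials whose `n`-th coefficient lies in `C n`. -/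
def MulFiltration.rees : Subring (Polynomial K) where
  carrier := {f | ∀ n, f.coeff n ∈ F.C n}
  zero_mem' n := by simp
  one_mem' n := by
    rw [Polynomial.coeff_one]
    split_ifs with h
    · subst h; exact F.one_mem
    · exact zero_mem _
  add_mem' hf hg n := by
    rw [Polynomial.coeff_add]; exact add_mem (hf n) (hg n)
  neg_mem' hf n := by
    rw [Polynomial.coeff_neg]; exact neg_mem (hf n)
  mul_mem' hf hg n := by
    rw [Polynomial.coeff_mul]
    refine sum_mem fun ij hij => ?_
    rw [← Finset.HasAntidiagonal.mem_antidiagonal.mp hij]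
    exact F.mul_mem_add (hf _) (hg _)

theorem mem_range_map_subtype {R : Type*} [CommRing R] (S : Subring R) (x : WittVector p R) :
    x ∈ (WittVector.map (p := p) S.subtype).range ↔ ∀ n, x.coeff n ∈ S := by
  constructor
  · rintro ⟨y, rfl⟩ n
    rw [WittVector.map_coeff]
    exact (y.coeff n).2
  · intro h
    refine ⟨WittVector.mk p fun n => ⟨x.coeff n, h n⟩, ?_⟩
    ext n
    simp [WittVector.map_coeff]

theorem MulFiltration.mem_iff (φ : WittVector p K) :
    (∀ n, φ.coeff n ∈ F.C (p ^ n)) ↔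
      WittVector.teichmuller p (Polynomial.X : Polynomial K) * WittVector.map Polynomial.C φ ∈
        (WittVector.map (p := p) F.rees.subtype).range := by
  rw [mem_range_map_subtype]
  refine forall_congr' fun n => ?_
  rw [teichmuller_mul_coeff, WittVector.map_coeff]
  change _ ↔ ∀ m, _
  simp only [Polynomial.X_pow_mul_C, Polynomial.coeff_C_mul_X_pow]
  constructor
  · intro h m
    split_ifs with hm
    · subst hm; exact h
    · exact zero_mem _
  · intro h
    simpa using h (p ^ n)

/-- Witt vectors `(φ_0, φ_1, ...)` with `φ_n ∈ C (p ^ n)` form a subgroup. -/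
def MulFiltration.witt : AddSubgroup (WittVector p K) where
  carrier := {φ | ∀ n, φ.coeff n ∈ F.C (p ^ n)}
  zero_mem' n := by rw [WittVector.zero_coeff]; exact zero_mem _
  add_mem' {x y} hx hy := by
    rw [Set.mem_ofPred_eq, F.mem_iff p] at *
    rw [map_add, mul_add]
    exact add_mem hx hy
  neg_mem' {x} hx := by
    rw [Set.mem_ofPred_eq, F.mem_iff p] at *
    rw [map_neg, mul_neg]
    exact neg_mem hx

theorem MulFiltration.mul_mem_witt {a φ : WittVector p K} (ha : ∀ n, a.coeff n ∈ F.C 0)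
    (hφ : φ ∈ F.witt p) : a * φ ∈ F.witt p := by
  have hφ' := (F.mem_iff p φ).mp hφ
  refine (F.mem_iff p _).mpr ?_
  rw [map_mul, mul_left_comm]
  refine mul_mem ?_ hφ'
  rw [mem_range_map_subtype]
  intro n m
  rw [WittVector.map_coeff, Polynomial.coeff_C]
  split_ifs with h
  · subst h; exact ha n
  · exact zero_mem _

/-- Truncated Witt vectors `(φ_0, ..., φ_(n-1))` with `φ_i ∈ C (p ^ i)` form a subgroup. -/
def MulFiltration.truncWitt (n : ℕ) : AddSubgroup (TruncatedWittVector p n K) :=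
  ((F.witt p).map (WittVector.truncate n : WittVector p K →+* _).toAddMonoidHom).copy
    {φ | ∀ i : Fin n, φ.coeff i ∈ F.C (p ^ (i : ℕ))} (by
      ext φ
      constructor
      · intro h
        refine ⟨φ.out, fun m => ?_, TruncatedWittVector.truncateFun_out φ⟩
        simp only [TruncatedWittVector.out]
        split_ifs with hm
        · exact h ⟨m, hm⟩
        · exact zero_mem _
      · rintro ⟨ψ, hψ, rfl⟩ i
        exact (WittVector.coeff_truncate ψ i).symm ▸ hψ i)

/-- The ring homomorphism on truncated Witt vectors applying `f` to every component. -/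
def truncMap (n : ℕ) {R S : Type*} [CommRing R] [CommRing S] (f : R →+* S) :
    TruncatedWittVector p n R →+* TruncatedWittVector p n S :=
  have h : ∀ x : WittVector p R,
      TruncatedWittVector.mk p (fun i => f ((WittVector.truncate n x).coeff i)) =
        WittVector.truncate n (WittVector.map f x) := fun x => by
    ext i
    simp [WittVector.coeff_truncate, WittVector.map_coeff]
  { toFun := fun x => TruncatedWittVector.mk p fun i => f (x.coeff i)
    map_one' := by
      rw [← map_one (WittVector.truncate n), h, map_one, map_one]
    map_zero' := by
      rw [← map_zero (WittVector.truncate n), h, map_zero, map_zero]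
    map_mul' := fun x y => by
      obtain ⟨x, rfl⟩ := WittVector.truncate_surjective p n R x
      obtain ⟨y, rfl⟩ := WittVector.truncate_surjective p n R y
      rw [← map_mul, h, h, h, map_mul, map_mul]
    map_add' := fun x y => by
      obtain ⟨x, rfl⟩ := WittVector.truncate_surjective p n R x
      obtain ⟨y, rfl⟩ := WittVector.truncate_surjective p n R y
      rw [← map_add, h, h, h, map_add, map_add] }

@[simp] theorem truncMap_coeff (n : ℕ) {R S : Type*} [CommRing R] [CommRing S] (f : R →+* S)
    (x : TruncatedWittVector p n R) (i : Fin n) :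
    (truncMap p n f x).coeff i = f (x.coeff i) := by
  simp [truncMap]

theorem MulFiltration.mul_mem_truncWitt (n : ℕ) {a φ : TruncatedWittVector p n K}
    (ha : ∀ i, a.coeff i ∈ F.C 0) (hφ : φ ∈ F.truncWitt p n) : a * φ ∈ F.truncWitt p n := by
  have hout : ∀ {G : ℕ → AddSubgroup K} {x : TruncatedWittVector p n K},
      (∀ i : Fin n, x.coeff i ∈ G i) → ∀ m, x.out.coeff m ∈ G m := by
    intro G x h m
    simp only [TruncatedWittVector.out]
    split_ifs with hm
    · exact h ⟨m, hm⟩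
    · exact zero_mem _
  have h := F.mul_mem_witt p (a := a.out) (φ := φ.out) (hout (G := fun _ => F.C 0) ha)
    (hout (G := fun m => F.C (p ^ m)) hφ)
  intro i
  have e : a * φ = WittVector.truncate n (a.out * φ.out) := by
    rw [map_mul]
    congr 1
    · exact (TruncatedWittVector.truncateFun_out a).symm
    · exact (TruncatedWittVector.truncateFun_out φ).symm
  rw [e, WittVector.coeff_truncate]
  exact h i

/-- `R ↦ W(R)`. -/
def wittFunctor : CommRingCat.{u} ⥤ CommRingCat.{u} where
  obj R := CommRingCat.of (WittVector p R)
  map f := CommRingCat.ofHom (WittVector.map f.hom)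
  map_id _ := by ext x n; simp
  map_comp f g := by ext x n; simp [WittVector.map_coeff]

/-- `R ↦ W_n(R)`. -/
def truncWittFunctor (n : ℕ) : CommRingCat.{u} ⥤ CommRingCat.{u} where
  obj R := CommRingCat.of (TruncatedWittVector p n R)
  map f := CommRingCat.ofHom (truncMap p n f.hom)
  map_id _ := CommRingCat.hom_ext <| RingHom.ext fun x => TruncatedWittVector.ext fun i =>
    truncMap_coeff p n _ x i
  map_comp f g := CommRingCat.hom_ext <| RingHom.ext fun x => TruncatedWittVector.ext fun i =>
    (truncMap_coeff p n _ x i).trans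
      ((truncMap_coeff p n g.hom _ i).trans (congrArg g (truncMap_coeff p n f.hom x i))).symm

end WittAlgebra

section Divisors

/-- A scheme is normal if all its local rings are integrally closed. -/
class IsNormalScheme (X : Scheme.{u}) : Prop where
  isIntegrallyClosed_stalk (x : X) : IsIntegrallyClosed (X.presheaf.stalk x)

/-- An `ℝ`-divisor on `X`: a formal sum, with real coefficients and locally finite support, of points
of codimension one (the generic points of the prime divisors). On a Noetherian scheme the support
is finite. -/
structure RDivisor (X : Scheme.{u}) where
  coeff : AlgebraicCycle X ℝ
  coeff_eq_zero (x : X) (hx : Order.coheight x ≠ 1) : coeff x = 0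

theorem isDiscreteValuationRing_stalk (X : Scheme.{u}) [IsIntegral X] [IsLocallyNoetherian X]
    [IsNormalScheme X] (x : X) (hx : Order.coheight x = 1) :
    IsDiscreteValuationRing (X.presheaf.stalk x) := by
  have hdim : ringKrullDim (X.presheaf.stalk x) = 1 := by
    rw [ringKrullDim_stalk_eq_coheight, hx]; rfl
  have hf : ¬ IsField (X.presheaf.stalk x) := fun h => by
    rw [ringKrullDim_eq_zero_of_isField h] at hdim
    exact zero_ne_one hdim
  have := IsNormalScheme.isIntegrallyClosed_stalk x
  have : Ring.KrullDimLE 1 (X.presheaf.stalk x) := krullDimLE_of_coheight_le hx.le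
  have : Ring.DimensionLEOne (X.presheaf.stalk x) :=
    ⟨fun h0 hP => Ring.krullDimLE_one_iff_of_noZeroDivisors.mp ‹_› _ h0 hP⟩
  have hD : IsDedekindDomain (X.presheaf.stalk x) := {}
  exact ((IsDiscreteValuationRing.TFAE (X.presheaf.stalk x) hf).out 2 0).mp hD

variable {X : Scheme.{u}} [IsIntegral X] [IsLocallyNoetherian X]

theorem ord_one (x : X) : Scheme.ord (1 : X.functionField) x = 0 := by
  have h := Scheme.ord_mul (x := x) (f := (1 : X.functionField)) (g := 1) one_ne_zero one_ne_zero
  rw [one_mul] at h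
  omega

theorem ord_neg (x : X) (b : X.functionField) : Scheme.ord (-b) x = Scheme.ord b x := by
  by_cases hb : b = 0
  · simp [hb]
  have h1 : Scheme.ord (-1 : X.functionField) x = 0 := by
    have h := Scheme.ord_mul (x := x) (f := (-1 : X.functionField)) (g := -1)
      (by simp) (by simp)
    rw [neg_mul_neg, one_mul, ord_one] at h
    omega
  rw [neg_eq_neg_one_mul, Scheme.ord_mul (by simp) hb, h1, zero_add]

variable [IsNormalScheme X]

/-- For a point `x` of codimension one and `m ≥ 0`, the subgroup `C m` of `K(X)` consists of all `b`
such that the coefficient of `div(b) + m D` at `x` is nonnegative (by convention `b = 0` qualifies).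
There is no condition at the other points. Thus `b` is a section of `𝒪_X(m D)` over `U` if and only
if it lies in `C m` for all points `x` of `U`. -/
def RDivisor.filtration (D : RDivisor X) (x : X) : MulFiltration X.functionField where
  C m :=
    { carrier := {b | Order.coheight x = 1 → b ≠ 0 → 0 ≤ (Scheme.ord b x : ℝ) + m * D.coeff x}
      zero_mem' := fun _ h => absurd rfl h
      add_mem' := by
        intro a b ha hb hx hab
        have := isDiscreteValuationRing_stalk X x hx
        by_cases ha0 : a = 0
        · subst ha0; simpa using hb hx (by simpa using hab)
        by_cases hb0 : b = 0
        · subst hb0; simpa using ha hx (by simpa using hab)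
        have h : ((min (Scheme.ord a x) (Scheme.ord b x) : ℤ) : ℝ) ≤ (Scheme.ord (a + b) x : ℝ) :=
          Int.cast_le.mpr (Scheme.ord_add hab)
        rcases min_choice (Scheme.ord a x) (Scheme.ord b x) with h' | h' <;> rw [h'] at h
        · linarith [ha hx ha0]
        · linarith [hb hx hb0]
      neg_mem' := by
        intro a ha hx ha0
        rw [ord_neg]
        exact ha hx (by simpa using ha0) }
  one_mem := fun _ _ => by simp [ord_one]
  mul_mem_add := by
    intro m n a b ha hb hx hab
    have ha0 : a ≠ 0 := left_ne_zero_of_mul hab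
    have hb0 : b ≠ 0 := right_ne_zero_of_mul hab
    have h1 := ha hx ha0
    have h2 := hb hx hb0
    rw [Scheme.ord_mul ha0 hb0]
    push_cast
    linarith

/-- The canonical map `Γ(U, 𝒪_X) ⟶ K(X)` for an open set `U` that contains a point `x`. -/
def toFunctionField {U : X.Opens} (x : U) : Γ(X, U) ⟶ X.functionField :=
  haveI : Nonempty U := ⟨x⟩
  X.germToFunctionField U

theorem toFunctionField_mem (D : RDivisor X) {U : X.Opens} (x : U) (a : Γ(X, U)) :
    toFunctionField x a ∈ (D.filtration x.1).C 0 := by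
  intro hx ha
  have : Nonempty U := ⟨x⟩
  have h := Scheme.ord_le_smul (x := x.1) x.2 (a := a)
    (by rintro rfl; exact ha (map_zero _)) (1 : X.functionField)
  rw [ord_one, Algebra.smul_def, mul_one] at h
  simp only [Nat.cast_zero, zero_mul, add_zero]
  exact_mod_cast h

end Divisors

section Sheaves

/-- `W` is, as a functor to sets, a power `R ↦ (J → R)` of the identity. Both the Witt vectors
(`J = ℕ`) and the Witt vectors of length `n` are of this form. -/
def HasComponents (W : CommRingCat.{u} ⥤ CommRingCat.{u}) : Prop :=
  ∃ (J : Type) (c : ∀ R : CommRingCat.{u}, W.obj R ≃ (J → R)),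
    ∀ (R S : CommRingCat.{u}) (f : R ⟶ S) (x : W.obj R) (j : J), c S (W.map f x) j = f (c R x j)

theorem wittFunctor_hasComponents (p : ℕ) [Fact p.Prime] :
    HasComponents (wittFunctor.{u} p) :=
  ⟨ℕ, fun _ => ⟨WittVector.coeff, WittVector.mk p, fun x => WittVector.ext fun _ => rfl,
    fun _ => rfl⟩, fun _ _ f x j => WittVector.map_coeff f.hom x j⟩

theorem truncWittFunctor_hasComponents (p : ℕ) [Fact p.Prime] (n : ℕ) :
    HasComponents (truncWittFunctor.{u} p n) :=
  ⟨ULift (Fin n), fun R => ⟨fun x i => TruncatedWittVector.coeff i.down x,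
    fun g => TruncatedWittVector.mk p fun i => g ⟨i⟩,
    fun x => TruncatedWittVector.ext fun i => TruncatedWittVector.coeff_mk _ _,
    fun g => funext fun i => TruncatedWittVector.coeff_mk _ _⟩,
    fun _ _ f x j => truncMap_coeff p n f.hom x j.down⟩

theorem isSheaf_comp {W : CommRingCat.{u} ⥤ CommRingCat.{u}} (hW : HasComponents W)
    (X : Scheme.{u}) :
    TopCat.Presheaf.IsSheaf (X.presheaf ⋙ W ⋙ forget₂ CommRingCat.{u} RingCat.{u}) := by
  obtain ⟨J, c, hc⟩ := hW
  rw [TopCat.Presheaf.isSheaf_iff_isSheafUniqueGluing]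
  intro ι U sf hsf
  have hcpt : ∀ j : J, TopCat.Presheaf.IsCompatible X.presheaf U
      (fun i => (c _ (sf i) j : Γ(X, U i))) := fun j i i' => by
    refine (hc _ _ _ _ _).symm.trans (Eq.trans ?_ (hc _ _ _ _ _))
    exact congrArg (fun z => c _ z j) (hsf i i')
  choose g hg hu using fun j => TopCat.Sheaf.existsUnique_gluing X.sheaf U _ (hcpt j)
  refine ⟨(c _).symm g, fun i => ?_, fun s hs => ?_⟩
  · apply (c _).injective
    funext j
    refine (hc _ _ _ _ _).trans ?_
    refine Eq.trans ?_ (hg j i)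
    exact congrArg (X.presheaf.map (Opens.leSupr U i).op)
      (congrFun ((c (X.presheaf.obj (op (iSup U)))).apply_symm_apply g) j)
  · apply (c _).injective
    funext j
    refine Eq.trans ?_ (congrFun ((c (X.presheaf.obj (op (iSup U)))).apply_symm_apply g) j).symm
    refine hu j _ fun i => ?_
    refine (hc _ _ _ _ _).symm.trans ?_
    exact congrArg (fun z => c _ z j) (hs i)

/-- The sheaf of rings `W𝒪_X : U ↦ W(Γ(U, 𝒪_X))`. -/
def ringSheaf {W : CommRingCat.{u} ⥤ CommRingCat.{u}} (hW : HasComponents W) (X : Scheme.{u}) :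
    Sheaf (Opens.grothendieckTopology X) RingCat.{u} :=
  ⟨X.presheaf ⋙ W ⋙ forget₂ CommRingCat.{u} RingCat.{u}, isSheaf_comp hW X⟩

/-- The morphism of sheaves of rings `W𝒪_Y ⟶ f_* W𝒪_X` induced by `f`. -/
def ringSheafHom {W : CommRingCat.{u} ⥤ CommRingCat.{u}} (hW : HasComponents W)
    {X Y : Scheme.{u}} (f : X ⟶ Y) :
    ringSheaf hW Y ⟶ ((Opens.map f.base).sheafPushforwardContinuous RingCat.{u}
      (Opens.grothendieckTopology Y) (Opens.grothendieckTopology X)).obj (ringSheaf hW X) where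
  hom := Functor.whiskerRight f.c (W ⋙ forget₂ CommRingCat.{u} RingCat.{u})

variable {X : Scheme.{u}} [IsIntegral X]
variable {W : CommRingCat.{u} ⥤ CommRingCat.{u}}

/-- A family of subgroups `S x` of `W(K(X))`, indexed by the points `x` of `X`, such that `S x` is
stable under multiplication by the sections of `W𝒪_X` over the neighbourhoods of `x`. -/
structure PointwiseSubmodule (W : CommRingCat.{u} ⥤ CommRingCat.{u}) (X : Scheme.{u})
    [IsIntegral X] where
  S : X → AddSubgroup (W.obj X.functionField)
  smul_mem (U : X.Opens) (x : U) (a : W.obj Γ(X, U)) (s : W.obj X.functionField)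
    (hs : s ∈ S x) : W.map (toFunctionField x) a * s ∈ S x

namespace PointwiseSubmodule

variable (M : PointwiseSubmodule W X)

/-- The sections over `U`: the sections `φ` of the constant sheaf `W(K(X))` on `U`, that is, the
locally constant functions on `U`, with `φ x ∈ S x` for all points `x` of `U`. -/
def sections (U : X.Opens) : AddSubgroup (U → W.obj X.functionField) where
  carrier := {φ | IsLocallyConstant φ ∧ ∀ x : U, φ x ∈ M.S x}
  zero_mem' := ⟨IsLocallyConstant.const 0, fun _ => zero_mem _⟩
  add_mem' h h' := ⟨h.1.add h'.1, fun x => add_mem (h.2 x) (h'.2 x)⟩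
  neg_mem' h := ⟨h.1.neg, fun x => neg_mem (h.2 x)⟩

/-- `W𝒪_X` acts by multiplication in `W(K(X))`. -/
instance (U : X.Opens) : Module (W.obj Γ(X, U)) (M.sections U) where
  smul a φ := ⟨fun x => W.map (toFunctionField x) a * φ.1 x,
    (IsLocallyConstant.of_constant _ fun _ _ => rfl).mul φ.2.1,
    fun x => M.smul_mem U x a _ (φ.2.2 x)⟩
  one_smul φ := Subtype.ext <| funext fun x =>
    (congrArg (· * φ.1 x) (map_one _)).trans (one_mul _)
  mul_smul a b φ := Subtype.ext <| funext fun x =>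
    (congrArg (· * φ.1 x) (map_mul _ a b)).trans (mul_assoc _ _ _)
  smul_zero a := Subtype.ext <| funext fun x => mul_zero _
  smul_add a φ ψ := Subtype.ext <| funext fun x => mul_add _ _ _
  add_smul a b φ := Subtype.ext <| funext fun x =>
    (congrArg (· * φ.1 x) (map_add _ a b)).trans (add_mul _ _ _)
  zero_smul φ := Subtype.ext <| funext fun x =>
    (congrArg (· * φ.1 x) (map_zero _)).trans (zero_mul _)

/-- Restriction to a smaller open set. -/
def restrict {U V : X.Opens} (h : V ≤ U) : M.sections U →+ M.sections V where
  toFun φ := ⟨fun x => φ.1 ⟨x.1, h x.2⟩,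
    φ.2.1.comp_continuous (continuous_inclusion h), fun x => φ.2.2 ⟨x.1, h x.2⟩⟩
  map_zero' := rfl
  map_add' _ _ := rfl

/-- The presheaf of abelian groups of sections. -/
def abPresheaf : X.Opensᵒᵖ ⥤ Ab.{u} where
  obj U := AddCommGrpCat.of (M.sections U.unop)
  map i := AddCommGrpCat.ofHom (M.restrict i.unop.le)

instance (U : X.Opensᵒᵖ) :
    Module ((X.presheaf ⋙ W ⋙ forget₂ CommRingCat.{u} RingCat.{u}).obj U) (M.abPresheaf.obj U) :=
  inferInstanceAs (Module (W.obj Γ(X, U.unop)) (M.sections U.unop))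

/-- The presheaf of modules of sections. -/
def presheaf : PresheafOfModules.{u} (X.presheaf ⋙ W ⋙ forget₂ CommRingCat.{u} RingCat.{u}) :=
  PresheafOfModules.ofPresheaf M.abPresheaf fun U V i a φ => Subtype.ext <| funext fun x => by
    refine congrArg (· * _) ?_
    change W.map (toFunctionField (⟨x.1, i.unop.le x.2⟩ : U.unop)) a =
      W.map (toFunctionField x) (W.map (X.presheaf.map i) a)
    rw [← ConcreteCategory.comp_apply, ← W.map_comp]
    congr 3
    exact (X.presheaf.germ_res i.unop _ _).symm

theorem isSheaf : TopCat.Presheaf.IsSheaf M.abPresheaf := by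
  rw [TopCat.Presheaf.isSheaf_iff_isSheafUniqueGluing]
  intro ι U sf hsf
  have hsf' : ∀ (i j : ι) (x : X) (hi : x ∈ U i) (hj : x ∈ U j),
      (sf i).1 ⟨x, hi⟩ = (sf j).1 ⟨x, hj⟩ := fun i j x hi hj =>
    congrFun (congrArg Subtype.val (hsf i j)) ⟨x, hi, hj⟩
  have hx : ∀ x : (iSup U : X.Opens), ∃ i, x.1 ∈ U i := fun x => Opens.mem_iSup.mp x.2
  choose k hk using hx
  refine ⟨⟨fun x => (sf (k x)).1 ⟨x.1, hk x⟩, ?_, fun x => (sf (k x)).2.2 ⟨x.1, hk x⟩⟩,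
    fun i => Subtype.ext <| funext fun x => hsf' _ _ _ _ _, fun s hs =>
      Subtype.ext <| funext fun x => ?_⟩
  · rw [IsLocallyConstant.iff_exists_open]
    intro x
    obtain ⟨V, hV, hxV, hVc⟩ :=
      (IsLocallyConstant.iff_exists_open _).mp (sf (k x)).2.1 ⟨x.1, hk x⟩
    refine ⟨{y | ∃ h : y.1 ∈ U (k x), (⟨y.1, h⟩ : U (k x)) ∈ V}, ?_, ⟨hk x, hxV⟩, ?_⟩
    · obtain ⟨V', hV', rfl⟩ := isOpen_induced_iff.mp hV
      have : {y : (iSup U : X.Opens) | ∃ h : y.1 ∈ U (k x),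
          (⟨y.1, h⟩ : U (k x)) ∈ Subtype.val ⁻¹' V'} =
          Subtype.val ⁻¹' ((U (k x) : Set X) ∩ V') := by
        ext y
        simp
      rw [this]
      exact ((U (k x)).isOpen.inter hV').preimage continuous_subtype_val
    · rintro y ⟨h, hy⟩
      exact (hsf' _ _ _ _ _).trans (hVc _ hy)
  · exact congrFun (congrArg Subtype.val (hs (k x))) ⟨x.1, hk x⟩

/-- The sheaf of `W𝒪_X`-modules `U ↦ M.sections U`, a subsheaf of the constant sheaf `W(K(X))`. -/
def sheaf (hW : HasComponents W) : SheafOfModules.{u} (ringSheaf hW X) :=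
  ⟨M.presheaf, M.isSheaf⟩

end PointwiseSubmodule

end Sheaves

section FunctionField

variable {X Y : Scheme.{u}} [IsIntegral X] [IsIntegral Y] (f : X ⟶ Y) [IsDominant f]

theorem genericPoint_specializes : f (genericPoint X) ⤳ genericPoint Y := by
  have h := (genericPoint_spec X).image f.continuous
  refine IsGenericPoint.specializes h ?_
  rw [Set.image_univ, f.denseRange.closure_range]
  trivial

/-- The homomorphism of function fields `K(Y) ⟶ K(X)` induced by a dominant morphism `f : X ⟶ Y`,
that is, the stalk map of `f` at the generic point. -/
def functionFieldMap : Y.functionField ⟶ X.functionField :=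
  Y.presheaf.stalkSpecializes (genericPoint_specializes f) ≫ f.stalkMap (genericPoint X)

theorem functionFieldMap_toFunctionField {U : Y.Opens} (x : (f ⁻¹ᵁ U : X.Opens)) (a : Γ(Y, U)) :
    functionFieldMap f (toFunctionField (⟨f x.1, x.2⟩ : U) a) =
      toFunctionField x (f.app U a) := by
  have h : toFunctionField (⟨f x.1, x.2⟩ : U) ≫ functionFieldMap f =
      f.app U ≫ toFunctionField x := by
    simp only [toFunctionField, functionFieldMap, Scheme.germToFunctionField]
    rw [TopCat.Presheaf.germ_stalkSpecializes_assoc, Scheme.Hom.germ_stalkMap]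
  exact congrArg (fun g => g.hom a) h

theorem functionFieldMap_algebraMap (x : X) (a : Y.presheaf.stalk (f x)) :
    functionFieldMap f (algebraMap _ Y.functionField a) =
      algebraMap (X.presheaf.stalk x) X.functionField (f.stalkMap x a) := by
  have hx : genericPoint X ⤳ x := (genericPoint_spec X).specializes trivial
  have hy : genericPoint Y ⤳ f x := (genericPoint_spec Y).specializes trivial
  have h : Y.presheaf.stalkSpecializes hy ≫ functionFieldMap f =
      f.stalkMap x ≫ X.presheaf.stalkSpecializes hx := by
    rw [functionFieldMap, TopCat.Presheaf.stalkSpecializes_comp_assoc]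
    exact Scheme.Hom.stalkSpecializes_stalkMap f _ _ hx
  exact congrArg (fun g => g.hom a) h

end FunctionField

section Pullback

variable {X Y : Scheme.{u}}

/-- The ramification index of `f` at `x`: the length of `𝒪_{X,x} / 𝔪_{f(x)} 𝒪_{X,x}`. If `x` and
`f x` are regular points of codimension one, it is the order at `x` of the pullback of a local
equation of the prime divisor with generic point `f x`. -/
def ramificationIndex (f : X ⟶ Y) (x : X) : ℕ :=
  (Module.length (X.presheaf.stalk x) (X.presheaf.stalk x ⧸
    (IsLocalRing.maximalIdeal (Y.presheaf.stalk (f x))).map (f.stalkMap x).hom)).toNat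

open Classical in
/-- The pullback `f^* D` of an `ℝ`-divisor by a finite morphism `f : X ⟶ Y`: the coefficient at a
point `x` of codimension one is the ramification index of `f` at `x` times the coefficient of `D`
at `f x`. So `f^* (div ψ) = div (f^* ψ)`, see `ord_functionFieldMap`, and `f^* D` is obtained near
`x` by pulling back a local equation of `D`. -/
def RDivisor.pullback (D : RDivisor Y) (f : X ⟶ Y) [IsFinite f] : RDivisor X where
  coeff :=
    { toFun := fun x =>
        if Order.coheight x = 1 then (ramificationIndex f x : ℝ) * D.coeff (f x) else 0
      supportWithinDomain' := Set.subset_univ _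
      supportLocallyFiniteWithinDomain' := by
        intro z _
        obtain ⟨t, ht, hfin⟩ := D.coeff.supportLocallyFiniteWithinDomain' (f z) trivial
        refine ⟨f ⁻¹' t, f.continuous.continuousAt.preimage_mem_nhds ht,
          (f.finite_preimage hfin).subset ?_⟩
        rintro x ⟨hxt, hx⟩
        refine ⟨hxt, fun h => hx ?_⟩
        have h' : D.coeff (f x) = 0 := h
        simp [h'] }
  coeff_eq_zero x hx := if_neg hx

theorem ord_algebraMap {X : Scheme.{u}} [IsIntegral X] [IsLocallyNoetherian X] (x : X)
    (hx : Order.coheight x = 1) (r : X.presheaf.stalk x) (hr : r ≠ 0) :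
    Scheme.ord (algebraMap _ X.functionField r) x =
      (Ring.ord (X.presheaf.stalk x) r).toNat := by
  have : Ring.KrullDimLE 1 (X.presheaf.stalk x) := krullDimLE_of_coheight_le hx.le
  have hr' : r ∈ nonZeroDivisors (X.presheaf.stalk x) := mem_nonZeroDivisors_of_ne_zero hr
  have hinj := FaithfulSMul.algebraMap_injective (X.presheaf.stalk x) X.functionField
  rw [Scheme.ord_eq_iff hx ((map_ne_zero_iff _ hinj).mpr hr)]
  refine (Ring.ordFrac_eq_ord (X.presheaf.stalk x) (K := X.functionField) hr).trans ?_
  exact Ring.ordMonoidWithZeroHom_eq_coe _ hr' (ENat.natCast_toNat (Ring.ord_ne_top hr')).symm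

variable [IsIntegral X] [IsLocallyNoetherian X] [IsIntegral Y] [IsLocallyNoetherian Y]
  [IsNormalScheme Y]

theorem ord_functionFieldMap (f : X ⟶ Y) [IsDominant f] (x : X) (hx : Order.coheight x = 1)
    (hy : Order.coheight (f x) = 1) (b : Y.functionField) (hb : b ≠ 0) :
    Scheme.ord (functionFieldMap f b) x = ramificationIndex f x * Scheme.ord b (f x) := by
  have := isDiscreteValuationRing_stalk Y (f x) hy
  have hinjX := FaithfulSMul.algebraMap_injective (X.presheaf.stalk x) X.functionField
  have hinjY := FaithfulSMul.algebraMap_injective (Y.presheaf.stalk (f x)) Y.functionField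
  have hφ : Function.Injective (functionFieldMap f).hom := (functionFieldMap f).hom.injective
  have hs : ∀ r : Y.presheaf.stalk (f x), r ≠ 0 → f.stalkMap x r ≠ 0 := fun r hr h => by
    have := functionFieldMap_algebraMap f x r
    rw [h, map_zero] at this
    exact hr ((map_eq_zero_iff _ hinjY).mp ((map_eq_zero_iff _ hφ).mp this))
  obtain ⟨ϖ, hϖ⟩ := IsDiscreteValuationRing.exists_irreducible (Y.presheaf.stalk (f x))
  have main : ∀ r : Y.presheaf.stalk (f x), r ≠ 0 →
      Scheme.ord (functionFieldMap f (algebraMap _ _ r)) x =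
        ramificationIndex f x * Scheme.ord (algebraMap _ Y.functionField r) (f x) := by
    intro r hr
    have h1 := hs r hr
    rw [functionFieldMap_algebraMap, ord_algebraMap x hx _ h1, ord_algebraMap _ hy _ hr]
    obtain ⟨n, u, rfl⟩ := IsDiscreteValuationRing.eq_unit_mul_pow_irreducible hr hϖ
    rw [map_mul, map_pow, Ring.ord_mul_of_isUnit_left u.isUnit,
      Ring.ord_mul_of_isUnit_left (u.isUnit.map (f.stalkMap x).hom),
      Ring.ord_pow (mem_nonZeroDivisors_of_ne_zero (hs _ hϖ.ne_zero)),
      Ring.ord_pow (mem_nonZeroDivisors_of_ne_zero hϖ.ne_zero), Ring.ord_of_irreducible hϖ]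
    have he : ramificationIndex f x =
        (Ring.ord (X.presheaf.stalk x) (f.stalkMap x ϖ)).toNat := by
      rw [ramificationIndex, Ring.ord, hϖ.maximalIdeal_eq, Ideal.map_span, Set.image_singleton]
    rw [he]
    simp [mul_comm]
  obtain ⟨r, s, hs0, rfl⟩ := IsFractionRing.div_surjective (A := Y.presheaf.stalk (f x)) b
  have hr0 : r ≠ 0 := by rintro rfl; simp at hb
  have hs0' : s ≠ 0 := nonZeroDivisors.ne_zero hs0
  have hb' : algebraMap _ Y.functionField r / algebraMap _ _ s * algebraMap _ _ s =
      algebraMap _ Y.functionField r :=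
    div_mul_cancel₀ _ ((map_ne_zero_iff _ hinjY).mpr hs0')
  have hsY : algebraMap _ Y.functionField s ≠ 0 := (map_ne_zero_iff _ hinjY).mpr hs0'
  have e1 := main r hr0
  have e2 := main s hs0'
  rw [← hb', map_mul, Scheme.ord_mul ((map_ne_zero_iff _ hφ).mpr hb)
    ((map_ne_zero_iff _ hφ).mpr hsY), Scheme.ord_mul hb hsY, e2] at e1
  linarith

theorem coheight_image (f : X ⟶ Y) [IsFinite f] [IsDominant f] (x : X)
    (hx : Order.coheight x = 1) : Order.coheight (f x) = 1 := by
  obtain ⟨V, hV, hxV, -⟩ := exists_isAffineOpen_mem_and_subset (X := Y) (x := f x) (U := ⊤) trivial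
  have hU : IsAffineOpen (f ⁻¹ᵁ V) := hV.preimage f
  have : Nonempty V := ⟨⟨f x, hxV⟩⟩
  have : Nonempty (f ⁻¹ᵁ V : X.Opens) := ⟨⟨x, hxV⟩⟩
  have hint : (f.app V).hom.IsIntegral := f.isIntegral_app V hV
  have hinj : Function.Injective (f.app V).hom := by
    intro a b hab
    have ha := functionFieldMap_toFunctionField f (U := V) ⟨x, hxV⟩ a
    have hb := functionFieldMap_toFunctionField f (U := V) ⟨x, hxV⟩ b
    have hab' : f.app V a = f.app V b := hab
    rw [hab', ← hb] at ha
    exact Y.germToFunctionField_injective V ((functionFieldMap f).hom.injective ha)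
  algebraize [(f.app V).hom]
  have : FaithfulSMul Γ(Y, V) Γ(X, f ⁻¹ᵁ V) := (faithfulSMul_iff_algebraMap_injective _ _).mpr hinj
  have : IsIntegrallyClosed Γ(Y, V) := by
    refine IsIntegrallyClosed.of_localization_maximal fun P _ _ => ?_
    have hmem : hV.fromSpec ⟨P, inferInstance⟩ ∈ V := (hV.isoSpec.inv _).2
    let : Algebra Γ(Y, V) (Y.presheaf.stalk (hV.fromSpec ⟨P, inferInstance⟩)) :=
      TopCat.Presheaf.algebra_section_stalk Y.presheaf ⟨_, hmem⟩
    have : IsLocalization.AtPrime (Y.presheaf.stalk (hV.fromSpec ⟨P, inferInstance⟩)) P :=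
      hV.isLocalization_stalk' ⟨P, inferInstance⟩ hmem
    have := IsNormalScheme.isIntegrallyClosed_stalk (hV.fromSpec ⟨P, inferInstance⟩)
    exact IsIntegrallyClosed.of_equiv (IsLocalization.algEquiv P.primeCompl
      (Y.presheaf.stalk (hV.fromSpec ⟨P, inferInstance⟩)) (Localization.AtPrime P)).toRingEquiv
  have : IsNoetherianRing Γ(X, f ⁻¹ᵁ V) := IsLocallyNoetherian.component_noetherian ⟨_, hU⟩
  have : IsNoetherianRing Γ(Y, V) := IsLocallyNoetherian.component_noetherian ⟨_, hV⟩
  set Q := (hU.primeIdealOf ⟨x, hxV⟩).asIdeal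
  set P := (hV.primeIdealOf ⟨f x, hxV⟩).asIdeal
  have hPQ : Q.comap (f.app V).hom = P := by
    have h := IsAffineOpen.comap_primeIdealOf_appLE (f := f) V hV (f ⁻¹ᵁ V) hU le_rfl (x := x) hxV
    rw [Scheme.Hom.appLE_eq_app] at h
    exact congrArg PrimeSpectrum.asIdeal h
  have hlo : Q.LiesOver P := ⟨hPQ.symm⟩
  have hQ1 : Q.height = 1 := by
    let := X.presheaf.algebra_section_stalk (U := f ⁻¹ᵁ V) ⟨x, hxV⟩
    have : IsLocalization.AtPrime (X.presheaf.stalk x) Q := hU.isLocalization_stalk ⟨x, hxV⟩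
    have h := IsLocalization.AtPrime.ringKrullDim_eq_height Q (X.presheaf.stalk x)
    rw [ringKrullDim_stalk_eq_coheight, hx] at h
    exact_mod_cast h.symm
  have hP1 : P.height = Order.coheight (f x) := by
    let := Y.presheaf.algebra_section_stalk (U := V) ⟨f x, hxV⟩
    have : IsLocalization.AtPrime (Y.presheaf.stalk (f x)) P := hV.isLocalization_stalk ⟨f x, hxV⟩
    have h := IsLocalization.AtPrime.ringKrullDim_eq_height P (Y.presheaf.stalk (f x))
    rw [ringKrullDim_stalk_eq_coheight] at h
    exact_mod_cast h.symm
  rw [← hP1]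
  refine le_antisymm ?_ ?_
  · rw [← hQ1, Ideal.height_eq_height_add_of_liesOver_of_hasGoingDown P Q]
    exact le_self_add
  · rw [Order.one_le_iff_ne_zero, Ne, Ideal.height_eq_zero_iff_eq_bot]
    intro h0
    have : Q = ⊥ := Ideal.eq_bot_of_comap_eq_bot (R := Γ(Y, V)) (hPQ.trans h0)
    rw [this, Ideal.height_bot] at hQ1
    exact zero_ne_one hQ1

end Pullback

section PullbackMap

variable {X Y : Scheme.{u}} [IsIntegral X] [IsIntegral Y]
variable {W : CommRingCat.{u} ⥤ CommRingCat.{u}} (hW : HasComponents W)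

/-- The direct image `f_* M`, a sheaf of `W𝒪_Y`-modules through `W𝒪_Y ⟶ f_* W𝒪_X`. -/
def PointwiseSubmodule.pushforward (M : PointwiseSubmodule W X) (f : X ⟶ Y) :
    SheafOfModules.{u} (ringSheaf hW Y) :=
  (SheafOfModules.pushforward (ringSheafHom hW f)).obj (M.sheaf hW)

/-- The map `Γ(V, N) → Γ(f⁻¹(V), M)` induced by `W(K(Y)) → W(K(X))`. -/
def PointwiseSubmodule.pullbackSections (N : PointwiseSubmodule W Y) (M : PointwiseSubmodule W X)
    (f : X ⟶ Y) [IsDominant f]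
    (h : ∀ (x : X), ∀ s ∈ N.S (f x), W.map (functionFieldMap f) s ∈ M.S x) (V : Y.Opens) :
    N.sections V →+ M.sections (f ⁻¹ᵁ V) where
  toFun φ := ⟨fun x => W.map (functionFieldMap f) (φ.1 ⟨f x.1, x.2⟩),
    (φ.2.1.comp_continuous (f := fun x : (f ⁻¹ᵁ V : X.Opens) => (⟨f x.1, x.2⟩ : V))
      (by fun_prop)).comp _,
    fun x => h x.1 _ (φ.2.2 ⟨f x.1, x.2⟩)⟩
  map_zero' := Subtype.ext <| funext fun _ => map_zero _
  map_add' _ _ := Subtype.ext <| funext fun _ => map_add _ _ _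

theorem PointwiseSubmodule.pullbackSections_smul (N : PointwiseSubmodule W Y)
    (M : PointwiseSubmodule W X) (f : X ⟶ Y) [IsDominant f]
    (h : ∀ (x : X), ∀ s ∈ N.S (f x), W.map (functionFieldMap f) s ∈ M.S x) (V : Y.Opens)
    (a : W.obj Γ(Y, V)) (φ : N.sections V) :
    N.pullbackSections M f h V (a • φ) = W.map (f.app V) a • N.pullbackSections M f h V φ :=
  Subtype.ext <| funext fun x => by
    refine (map_mul (W.map (functionFieldMap f)).hom _ _).trans (congrArg (· * _) ?_)
    change W.map (functionFieldMap f) (W.map (toFunctionField (⟨f x.1, x.2⟩ : V)) a) =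
      W.map (toFunctionField x) (W.map (f.app V) a)
    rw [← ConcreteCategory.comp_apply, ← W.map_comp, ← ConcreteCategory.comp_apply, ← W.map_comp]
    congr 3
    ext b
    exact functionFieldMap_toFunctionField f x b

/-- The morphism of sheaves of `W𝒪_Y`-modules `N ⟶ f_* M` that is induced by
`W(K(Y)) → W(K(X))`. -/
def PointwiseSubmodule.pullbackHom (N : PointwiseSubmodule W Y) (M : PointwiseSubmodule W X)
    (f : X ⟶ Y) [IsDominant f]
    (h : ∀ (x : X), ∀ s ∈ N.S (f x), W.map (functionFieldMap f) s ∈ M.S x) :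
    N.sheaf hW ⟶ M.pushforward hW f where
  val :=
    { app := fun V => ModuleCat.ofHom (R := (ringSheaf hW Y).obj.obj V)
        (X := (N.sheaf hW).val.obj V) (Y := (M.pushforward hW f).val.obj V)
        { toFun := fun φ => N.pullbackSections M f h V.unop φ
          map_add' := fun φ ψ => (N.pullbackSections M f h V.unop).map_add φ ψ
          map_smul' := fun a φ => N.pullbackSections_smul M f h V.unop a φ }
      naturality := fun i => rfl }

end PullbackMap

section WittDivisorial

variable (p : ℕ) [Fact p.Prime]
variable {X Y : Scheme.{u}} [IsIntegral X] [IsLocallyNoetherian X] [IsNormalScheme X]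
  [IsIntegral Y] [IsLocallyNoetherian Y] [IsNormalScheme Y]

/-- The local conditions that define `W𝒪_X(D)`: `(φ_0, φ_1, ...) ∈ W(K(X))` is admitted at a point `x`
of codimension one if and only if, for all `n`, the coefficient of `div(φ_n) + p ^ n D` at `x` is
nonnegative. -/
def RDivisor.wittSubmodule (D : RDivisor X) : PointwiseSubmodule (wittFunctor p) X where
  S x := (D.filtration x).witt p
  smul_mem _ x a _ hs := (D.filtration x.1).mul_mem_witt p
    (fun n => (WittVector.map_coeff (toFunctionField x).hom a n).symm ▸
      toFunctionField_mem D x _) hs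

/-- The local conditions that define `W_n𝒪_X(D)`, a subsheaf of `W_n(K(X))`. -/
def RDivisor.truncWittSubmodule (n : ℕ) (D : RDivisor X) :
    PointwiseSubmodule (truncWittFunctor p n) X where
  S x := (D.filtration x).truncWitt p n
  smul_mem _ x a _ hs := (D.filtration x.1).mul_mem_truncWitt p n
    (fun i => (truncMap_coeff p n (toFunctionField x).hom a i).symm ▸
      toFunctionField_mem D x _) hs

theorem functionFieldMap_mem_filtration (D : RDivisor Y) (f : X ⟶ Y) [IsFinite f] [IsDominant f]
    (x : X) (m : ℕ) (b : Y.functionField) (hb : b ∈ (D.filtration (f x)).C m) :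
    functionFieldMap f b ∈ ((D.pullback f).filtration x).C m := by
  intro hx hb0
  have hb0' : b ≠ 0 := by rintro rfl; exact hb0 (map_zero _)
  have hy := coheight_image f x hx
  have h := hb hy hb0'
  have hD : (D.pullback f).coeff x = (ramificationIndex f x : ℝ) * D.coeff (f x) := if_pos hx
  rw [ord_functionFieldMap f x hx hy b hb0', hD]
  push_cast
  have := mul_nonneg (Nat.cast_nonneg (α := ℝ) (ramificationIndex f x)) h
  linarith

/-- The Witt divisorial sheaf `W𝒪_X(D)`, a sheaf of `W𝒪_X`-modules. -/
def RDivisor.wittSheaf (D : RDivisor X) :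
    SheafOfModules.{u} (ringSheaf (wittFunctor_hasComponents.{u} p) X) :=
  (D.wittSubmodule p).sheaf (wittFunctor_hasComponents p)

/-- The sheaf `W_n𝒪_X(D)` of `W_n𝒪_X`-modules. -/
def RDivisor.truncWittSheaf (n : ℕ) (D : RDivisor X) :
    SheafOfModules.{u} (ringSheaf (truncWittFunctor_hasComponents.{u} p n) X) :=
  (D.truncWittSubmodule p n).sheaf (truncWittFunctor_hasComponents p n)

/-- The morphism `W𝒪_Y(D) ⟶ f_* W𝒪_X(f^* D)` of `W𝒪_Y`-modules, for a finite dominant morphism. -/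
def RDivisor.wittPullback (D : RDivisor Y) (f : X ⟶ Y) [IsFinite f] [IsDominant f] :
    D.wittSheaf p ⟶
      (SheafOfModules.pushforward (ringSheafHom (wittFunctor_hasComponents p) f)).obj
        ((D.pullback f).wittSheaf p) :=
  (D.wittSubmodule p).pullbackHom (wittFunctor_hasComponents p) ((D.pullback f).wittSubmodule p) f
    fun x s hs n => (WittVector.map_coeff (functionFieldMap f).hom s n).symm ▸
      functionFieldMap_mem_filtration D f x _ _ (hs n)

/-- The morphism `W_n𝒪_Y(D) ⟶ f_* W_n𝒪_X(f^* D)` of `W_n𝒪_Y`-modules, for a finite dominant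
morphism. -/
def RDivisor.truncWittPullback (n : ℕ) (D : RDivisor Y) (f : X ⟶ Y) [IsFinite f] [IsDominant f] :
    D.truncWittSheaf p n ⟶
      (SheafOfModules.pushforward (ringSheafHom (truncWittFunctor_hasComponents p n) f)).obj
        ((D.pullback f).truncWittSheaf p n) :=
  (D.truncWittSubmodule p n).pullbackHom (truncWittFunctor_hasComponents p n)
    ((D.pullback f).truncWittSubmodule p n) f
    fun x s hs i => (truncMap_coeff p n (functionFieldMap f).hom s i).symm ▸
      functionFieldMap_mem_filtration D f x _ _ (hs i)

end WittDivisorial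

section Galois

/-- `X` is an `𝔽_p`-scheme: it has a (necessarily unique) morphism to `Spec 𝔽_p`. -/
def IsFpScheme (p : ℕ) (X : Scheme.{u}) : Prop :=
  Nonempty (X ⟶ Spec (CommRingCat.of (ULift.{u} (ZMod p))))

variable {X Y : Scheme.{u}} [IsIntegral X] [IsIntegral Y] (f : X ⟶ Y) [IsDominant f]

/-- `K(X)` as an extension of `K(Y)`. -/
abbrev functionFieldAlgebra : Algebra Y.functionField X.functionField :=
  (functionFieldMap f).hom.toAlgebra

/-- The field extension `K(X) / K(Y)` is Galois. -/
def IsGaloisExtension : Prop :=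
  @IsGalois Y.functionField _ X.functionField _ (functionFieldAlgebra f)

/-- The group of automorphisms of `K(X)` over `K(Y)`. -/
def GaloisGroup : Type u :=
  letI := functionFieldAlgebra f
  X.functionField ≃ₐ[Y.functionField] X.functionField

/-- An element of the Galois group as an endomorphism of the ring `K(X)`. -/
def GaloisGroup.hom {f : X ⟶ Y} [IsDominant f] (σ : GaloisGroup f) :
    X.functionField ⟶ X.functionField :=
  letI := functionFieldAlgebra f
  let τ : X.functionField ≃ₐ[Y.functionField] X.functionField := σ
  CommRingCat.ofHom τ.toRingEquiv.toRingHom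

/-- `T : f_* M ⟶ N` is the average `φ ↦ 1/|G| * ∑ σ, W(σ)(φ)` over the Galois group `G` of
`K(X) / K(Y)`: after multiplication by `|G|`, and in `W(K(X))`, the value of `T φ` is
`∑ σ, W(σ)(φ)`. -/
def PointwiseSubmodule.IsGaloisAverage {W : CommRingCat.{u} ⥤ CommRingCat.{u}}
    (hW : HasComponents W) (M : PointwiseSubmodule W X) (N : PointwiseSubmodule W Y)
    (T : M.pushforward hW f ⟶ N.sheaf hW) : Prop :=
  ∀ (V : Y.Opens) (φ : M.sections (f ⁻¹ᵁ V)) (ψ : N.sections V), T.val.app (op V) φ = ψ →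
    ∀ x : (f ⁻¹ᵁ V : X.Opens), Nat.card (GaloisGroup f) • W.map (functionFieldMap f)
      (ψ.1 ⟨f x.1, x.2⟩) = ∑ᶠ σ : GaloisGroup f, W.map σ.hom (φ.1 x)

end Galois

end

end WittDiv

namespace WittDiv

noncomputable section

open CategoryTheory TopologicalSpace Opposite AlgebraicGeometry

/-! ### Points of codimension one and integrality along a fibre of a finite morphism -/

section LocalRings

variable {X Y : Scheme.{u}} [IsIntegral X] [IsIntegral Y]

/-! Since `p` does not divide `|G|`, the integer `|G|` is a unit in `W(𝔽_p)`, hence in `W(K(Y))`,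
`W(K(X))` and their truncations. The Galois average is therefore defined on Witt vectors. It is
linear over the Witt vectors of `K(Y)` and restores a vector pulled back from `K(Y)`. The sum of
conjugates is `G`-invariant, and since `G` acts componentwise, Galois descent in each component
places it in `W(K(Y))`. What remains is that the average respects the divisor conditions.

The automorphisms in `G` are not extended to `X`, so no action on the fibres of `f` is available.
Instead, the conditions at all points over one codimension-one point `y` are treated together, by
integrality. Let `ψ` be a uniformizer at `y`. For rational `q = r/s`, the bound `ord_x b ≥ q e_x` at
every `x` over `y` says that `b ^ s * ψ ^ (-r)` lies in all local rings over `y`; it is then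
integral over `𝒪_{Y,y}` (`isIntegralElem_of_forall_mem_stalk`). Integrality is preserved by `σ ∈ G`,
and normality of `X` turns it back into the same bound for `σ b`. Real coefficients are reached by
approximating with rational `q` from below (`filtration_pullback_galois_stable`).

The Witt vectors satisfying the conditions form a group stable under multiplication by vectors with
components in `C 0`, so the sum of conjugates and its product with `1/|G|` still satisfy them.
Positivity of `e_x` carries the conditions from `X` back to `Y`. The truncated case follows by
padding with zeros and truncating the average. -/

theorem coheight_of_coheight_image (f : X ⟶ Y) [IsFinite f] [IsDominant f] (x : X)
    (hx : Order.coheight (f x) = 1) : Order.coheight x = 1 := by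
  -- Fibres of a finite morphism are discrete, so they contain no proper specializations. Hence `f`
  -- is strictly monotone for the specialization order and coheight cannot drop.
  have hmono : StrictMono f := by
    intro a b hab
    have hs : b ⤳ a := hab.le
    refine lt_of_le_not_ge (hs.map f.continuous) fun hle => hab.ne ?_
    have h : f a = f b := (Specializes.antisymm hle (hs.map f.continuous)).eq
    have hd : _root_.IsDiscrete (f ⁻¹' {f a}) := f.isDiscrete_preimage_singleton _
    have := hd.to_subtype
    have hs' : (⟨b, h.symm⟩ : f ⁻¹' {f a}) ⤳ ⟨a, rfl⟩ :=
      Topology.IsInducing.subtypeVal.specializes_iff.mp hs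
    exact (congrArg Subtype.val hs'.eq).symm
  refine le_antisymm (hx ▸ Order.coheight_le_coheight_apply_of_strictMono f hmono x) ?_
  rw [Order.one_le_iff_ne_zero, Order.coheight_ne_zero]
  intro hmax
  -- A point of coheight zero would be generic in `X`, and its image would then be generic in `Y`.
  have hgen : genericPoint X ⤳ x := (genericPoint_spec X).specializes trivial
  have hgx : x ⤳ genericPoint X := hmax hgen
  have hfx : f x ⤳ genericPoint Y := (hgx.map f.continuous).trans (genericPoint_specializes f)
  refine zero_ne_one (Eq.trans (Eq.symm ?_) hx)
  rw [Order.coheight_eq_zero]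
  intro z _
  exact hfx.trans ((genericPoint_spec Y).specializes trivial)

/-- The stalk is a valuation ring, so `b` or `b⁻¹` lies in it. If `b⁻¹` does and `b` has nonnegative
order, then `b⁻¹` has order zero, so the quotient by it has length zero and it is a unit. -/
theorem ord_nonneg_iff [IsLocallyNoetherian X] [IsNormalScheme X] (x : X)
    (hx : Order.coheight x = 1) (b : X.functionField) (hb : b ≠ 0) :
    0 ≤ Scheme.ord b x ↔ b ∈ (algebraMap (X.presheaf.stalk x) X.functionField).range := by
  have := isDiscreteValuationRing_stalk X x hx
  constructor
  · intro h
    obtain ⟨r, rfl⟩ | ⟨r, hr⟩ := ValuationRing.isInteger_or_isInteger (X.presheaf.stalk x) b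
    · exact ⟨r, rfl⟩
    have : Ring.KrullDimLE 1 (X.presheaf.stalk x) := krullDimLE_of_coheight_le hx.le
    have hr0 : r ≠ 0 := by rintro rfl; simp [eq_comm, hb] at hr
    have h1 := Scheme.ord_mul (x := x) hb (inv_ne_zero hb)
    rw [mul_inv_cancel₀ hb, ord_one, ← hr, ord_algebraMap x hx r hr0] at h1
    have h2 : (Ring.ord (X.presheaf.stalk x) r).toNat = 0 := by omega
    have h3 : Ring.ord (X.presheaf.stalk x) r = 0 := by
      rw [ENat.toNat_eq_zero] at h2
      exact h2.resolve_right (Ring.ord_ne_top (mem_nonZeroDivisors_of_ne_zero hr0))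
    rw [Ring.ord, Module.length_eq_zero_iff, Submodule.Quotient.subsingleton_iff,
      Ideal.span_singleton_eq_top] at h3
    obtain ⟨u, rfl⟩ := h3
    refine ⟨((u⁻¹ : (X.presheaf.stalk x)ˣ) : X.presheaf.stalk x), ?_⟩
    rw [← inv_inv b, ← hr]
    refine eq_inv_of_mul_eq_one_left ?_
    rw [← map_mul, Units.inv_mul, map_one]
  · rintro ⟨r, rfl⟩
    rw [ord_algebraMap x hx r (by rintro rfl; simp at hb)]
    positivity

/-- If the index were zero, a uniformizer at `f x` would pull back to a unit at `x`, which is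
impossible because the stalk map is a local homomorphism. -/
theorem ramificationIndex_pos [IsLocallyNoetherian X] [IsNormalScheme X] [IsLocallyNoetherian Y]
    [IsNormalScheme Y] (f : X ⟶ Y) [IsDominant f] (x : X) (hx : Order.coheight x = 1)
    (hy : Order.coheight (f x) = 1) : 0 < ramificationIndex f x := by
  have := isDiscreteValuationRing_stalk Y (f x) hy
  obtain ⟨ϖ, hϖ⟩ := IsDiscreteValuationRing.exists_irreducible (Y.presheaf.stalk (f x))
  have hinj := FaithfulSMul.algebraMap_injective (Y.presheaf.stalk (f x)) Y.functionField
  have hinjX := FaithfulSMul.algebraMap_injective (X.presheaf.stalk x) X.functionField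
  set b := algebraMap _ Y.functionField ϖ
  have hb : b ≠ 0 := (map_ne_zero_iff _ hinj).mpr hϖ.ne_zero
  have hb' : functionFieldMap f b ≠ 0 := (map_ne_zero (functionFieldMap f).hom).mpr hb
  by_contra h0
  have h := ord_functionFieldMap f x hx hy b hb
  rw [Nat.eq_zero_of_not_pos h0, Nat.cast_zero, zero_mul] at h
  have h2 := Scheme.ord_mul (x := x) hb' (inv_ne_zero hb')
  rw [mul_inv_cancel₀ hb', ord_one, h, zero_add] at h2
  obtain ⟨r, hr⟩ := (ord_nonneg_iff x hx _ (inv_ne_zero hb')).mp h2.le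
  have h3 : f.stalkMap x ϖ * r = 1 := by
    apply hinjX
    rw [map_mul, hr, ← functionFieldMap_algebraMap, map_one]
    exact mul_inv_cancel₀ hb'
  have h4 : IsUnit ((f.stalkMap x).hom ϖ) := IsUnit.of_mul_eq_one _ h3
  exact hϖ.not_isUnit (isUnit_of_map_unit _ _ h4)

/-- An element of `K(X)` that lies in all local rings of the points over `y` is integral over the
local ring of `y`. -/
theorem isIntegralElem_of_forall_mem_stalk (f : X ⟶ Y) [IsFinite f] [IsDominant f] (y : Y)
    (b : X.functionField) (hb : ∀ x : X, f x = y →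
      b ∈ (algebraMap (X.presheaf.stalk x) X.functionField).range) (hne : ∃ x, f x = y) :
    ((functionFieldMap f).hom.comp
      (algebraMap (Y.presheaf.stalk y) Y.functionField)).IsIntegralElem b := by
  obtain ⟨V, hV, hyV, -⟩ := exists_isAffineOpen_mem_and_subset (X := Y) (x := y) (U := ⊤) trivial
  have hU : IsAffineOpen (f ⁻¹ᵁ V) := hV.preimage f
  obtain ⟨x₀, rfl⟩ := hne
  have : Nonempty V := ⟨⟨f x₀, hyV⟩⟩
  have : Nonempty (f ⁻¹ᵁ V : X.Opens) := ⟨⟨x₀, hyV⟩⟩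
  have hint : (f.app V).hom.IsIntegral := f.isIntegral_app V hV
  -- The ideal of denominators of `b`: all `c` with `c * b` regular on `f⁻¹(V)`.
  let I : Ideal Γ(X, f ⁻¹ᵁ V) :=
    (LinearMap.range (Algebra.linearMap Γ(X, f ⁻¹ᵁ V) X.functionField)).comap
      (LinearMap.toSpanSingleton Γ(X, f ⁻¹ᵁ V) X.functionField b)
  have hmemI : ∀ c, c ∈ I ↔ ∃ r, algebraMap Γ(X, f ⁻¹ᵁ V) X.functionField r =
      algebraMap Γ(X, f ⁻¹ᵁ V) X.functionField c * b := fun c => by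
    simp [I, Algebra.smul_def]
  set P := (hV.primeIdealOf ⟨f x₀, hyV⟩).asIdeal
  -- Otherwise lying over gives a prime `Q ⊇ I` above `P`, that is, a point over `y`. The regularity
  -- of `b` there supplies a denominator outside `Q`, a contradiction.
  have hI : ¬ I.comap (f.app V).hom ≤ P := by
    intro hIP
    obtain ⟨Q, hIQ, hQ, hQP⟩ : ∃ Q ≥ I, Q.IsPrime ∧ Q.comap (f.app V).hom = P := by
      algebraize [(f.app V).hom]
      exact Ideal.exists_ideal_over_prime_of_isIntegral P I hIP
    set x := hU.fromSpec ⟨Q, hQ⟩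
    have hxU : x ∈ f ⁻¹ᵁ V := (hU.isoSpec.inv _).2
    have hxQ : hU.primeIdealOf ⟨x, hxU⟩ = ⟨Q, hQ⟩ :=
      hU.fromSpec.isOpenEmbedding.injective (hU.fromSpec_primeIdealOf _)
    have hfx : f x = f x₀ := by
      have h := IsAffineOpen.comap_primeIdealOf_appLE (f := f) V hV (f ⁻¹ᵁ V) hU le_rfl (x := x) hxU
      rw [Scheme.Hom.appLE_eq_app, hxQ] at h
      have h' : hV.primeIdealOf ⟨f x, hxU⟩ = hV.primeIdealOf ⟨f x₀, hyV⟩ :=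
        h.symm.trans (PrimeSpectrum.ext hQP)
      have h2 := hV.fromSpec_primeIdealOf ⟨f x, hxU⟩
      rw [h', hV.fromSpec_primeIdealOf] at h2
      exact h2.symm
    obtain ⟨r, hr⟩ := hb x hfx
    let := X.presheaf.algebra_section_stalk (U := f ⁻¹ᵁ V) ⟨x, hxU⟩
    have : IsLocalization.AtPrime (X.presheaf.stalk x) Q := by
      have h := hU.isLocalization_stalk ⟨x, hxU⟩
      rwa [hxQ] at h
    have : IsScalarTower Γ(X, f ⁻¹ᵁ V) (X.presheaf.stalk x) X.functionField :=
      functionField_isScalarTower X _ ⟨x, hxU⟩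
    obtain ⟨⟨c, s⟩, hs⟩ := IsLocalization.surj Q.primeCompl r
    refine s.2 (hIQ ((hmemI _).mpr ⟨c, ?_⟩))
    rw [← hr, IsScalarTower.algebraMap_apply _ (X.presheaf.stalk x) X.functionField c, ← hs,
      map_mul, ← IsScalarTower.algebraMap_apply, mul_comm]
  -- So some `a` on `V`, invertible at `y`, makes `r = a * b` regular on `f⁻¹(V)`. There `r` is
  -- integral over `Γ(Y, V)`, and `b = a⁻¹ * r`.
  obtain ⟨a, haI, haP⟩ := SetLike.not_le_iff_exists.mp hI
  obtain ⟨r, hr⟩ := (hmemI _).mp haI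
  let := Y.presheaf.algebra_section_stalk (U := V) ⟨f x₀, hyV⟩
  have : IsLocalization.AtPrime (Y.presheaf.stalk (f x₀)) P := hV.isLocalization_stalk ⟨f x₀, hyV⟩
  have : IsScalarTower Γ(Y, V) (Y.presheaf.stalk (f x₀)) Y.functionField :=
    functionField_isScalarTower Y _ ⟨f x₀, hyV⟩
  obtain ⟨u, hu⟩ := IsLocalization.map_units (Y.presheaf.stalk (f x₀)) (⟨a, haP⟩ : P.primeCompl)
  set j := (functionFieldMap f).hom.comp (algebraMap (Y.presheaf.stalk (f x₀)) Y.functionField) with hj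
  have hjA : j.comp (algebraMap Γ(Y, V) _) =
      (algebraMap Γ(X, f ⁻¹ᵁ V) X.functionField).comp (f.app V).hom := by
    rw [hj, RingHom.comp_assoc, ← IsScalarTower.algebraMap_eq]
    ext c
    exact functionFieldMap_toFunctionField f (U := V) ⟨x₀, hyV⟩ c
  have hrint : j.IsIntegralElem (algebraMap _ X.functionField r) := by
    obtain ⟨q, hq, hq0⟩ := hint r
    refine ⟨q.map (algebraMap Γ(Y, V) _), hq.map _, ?_⟩
    rw [Polynomial.eval₂_map, hjA, ← Polynomial.hom_eval₂, hq0, map_zero]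
  have hbr : b = j (u⁻¹ : (Y.presheaf.stalk (f x₀))ˣ) * algebraMap _ X.functionField r := by
    have h1 : algebraMap _ X.functionField ((f.app V).hom a) = j u := by
      rw [hu]; exact (congrArg (fun g => g a) hjA).symm
    rw [hr, h1, ← mul_assoc, ← map_mul, Units.inv_mul, map_one, one_mul]
  rw [hbr]
  exact (j.isIntegralElem_map).mul _ hrint

end LocalRings

/-! ### Galois stability and descent of the divisor conditions -/

section Stability

variable {X Y : Scheme.{u}} [IsIntegral X] [IsIntegral Y]

theorem ord_zpow [IsLocallyNoetherian X] (x : X) {a : X.functionField} (ha : a ≠ 0) (n : ℤ) :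
    Scheme.ord (a ^ n) x = n * Scheme.ord a x := by
  have hpow : ∀ k : ℕ, Scheme.ord (a ^ k) x = k * Scheme.ord a x := fun k => by
    induction k with
    | zero => simp [ord_one]
    | succ k ih =>
      rw [pow_succ, Scheme.ord_mul (pow_ne_zero k ha) ha, ih]
      push_cast
      ring
  obtain ⟨k, rfl | rfl⟩ := n.eq_nat_or_neg
  · rw [zpow_natCast, hpow]
  · have h := Scheme.ord_mul (x := x) (zpow_ne_zero (-(k : ℤ)) ha) (pow_ne_zero k ha)
    rw [← zpow_natCast, ← zpow_add₀ ha, neg_add_cancel, zpow_zero, ord_one, zpow_natCast, hpow] at h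
    linarith

variable {f : X ⟶ Y} [IsDominant f]

theorem GaloisGroup.hom_functionFieldMap (σ : GaloisGroup f) (b : Y.functionField) :
    σ.hom (functionFieldMap f b) = functionFieldMap f b :=
  letI := functionFieldAlgebra f
  AlgEquiv.commutes (σ : X.functionField ≃ₐ[Y.functionField] X.functionField) b

variable [IsLocallyNoetherian X] [IsNormalScheme X] [IsLocallyNoetherian Y] [IsNormalScheme Y]
  [IsFinite f]

/-- The hypothesis must cover the whole fibre, since `σ` may exchange the valuations over `y`.
Together these bounds amount to integrality statements over `𝒪_{Y,y}`, which `σ` preserves because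
it fixes `K(Y)`. -/
theorem filtration_pullback_galois_stable (D : RDivisor Y) (σ : GaloisGroup f) (y : Y)
    (hy : Order.coheight y = 1) (m : ℕ) (b : X.functionField)
    (hb : ∀ x, f x = y → b ∈ ((D.pullback f).filtration x).C m) (x : X) (hxy : f x = y) :
    σ.hom b ∈ ((D.pullback f).filtration x).C m := by
  intro hx hσb
  have hb0 : b ≠ 0 := by rintro rfl; exact hσb (map_zero _)
  have hcoeff : ∀ x', f x' = y → Order.coheight x' = 1 ∧
      (D.pullback f).coeff x' = ramificationIndex f x' * D.coeff y := by
    rintro x' rfl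
    have := coheight_of_coheight_image f x' hy
    exact ⟨this, if_pos this⟩
  have hpos : (0 : ℝ) < ramificationIndex f x :=
    Nat.cast_pos.mpr (ramificationIndex_pos f x hx (hxy ▸ hy))
  rw [(hcoeff x hxy).2]
  by_contra hlt
  -- The rational `q` separates the supposedly too small order of `σ b`, divided by `e_x`, from the
  -- real bound `-m D_y`. Clearing its denominator makes the comparison one between orders of
  -- functions.
  obtain ⟨q, hq1, hq2⟩ := exists_rat_btwn
    (show (Scheme.ord (σ.hom b) x : ℝ) / ramificationIndex f x < -(m * D.coeff y) by
      rw [div_lt_iff₀ hpos]; linarith)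
  rw [div_lt_iff₀ hpos] at hq1
  have hden : (0 : ℝ) < q.den := Nat.cast_pos.mpr q.den_pos
  have hqd : (q : ℝ) * q.den = q.num := by exact_mod_cast Rat.mul_den_eq_num q
  have := isDiscreteValuationRing_stalk Y y hy
  obtain ⟨ϖ, hϖ⟩ := IsDiscreteValuationRing.exists_irreducible (Y.presheaf.stalk y)
  have hinj := FaithfulSMul.algebraMap_injective (Y.presheaf.stalk y) Y.functionField
  set ψ := algebraMap _ Y.functionField ϖ
  have hψ : ψ ≠ 0 := (map_ne_zero_iff _ hinj).mpr hϖ.ne_zero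
  have hψ' : functionFieldMap f ψ ≠ 0 := (map_ne_zero (functionFieldMap f).hom).mpr hψ
  have hordψ : Scheme.ord ψ y = 1 := by
    rw [ord_algebraMap y hy ϖ hϖ.ne_zero, Ring.ord_of_irreducible hϖ]; rfl
  have hord : ∀ (x' : X) (a : X.functionField), f x' = y → a ≠ 0 →
      Scheme.ord (a ^ (q.den : ℤ) * functionFieldMap f ψ ^ (-q.num)) x' =
        q.den * Scheme.ord a x' - q.num * ramificationIndex f x' := by
    rintro x' a rfl ha
    rw [Scheme.ord_mul (zpow_ne_zero _ ha) (zpow_ne_zero _ hψ'), ord_zpow _ ha, ord_zpow _ hψ',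
      ord_functionFieldMap f x' (hcoeff x' rfl).1 hy ψ hψ, hordψ]
    ring
  -- At every point over `y` the order of `c` is `q.den * (ord b - q * e)`, which is nonnegative as
  -- `q < -m D_y`. At `x` the same formula for `σ c` gives a negative number.
  set c := b ^ (q.den : ℤ) * functionFieldMap f ψ ^ (-q.num)
  have hc0 : c ≠ 0 := mul_ne_zero (zpow_ne_zero _ hb0) (zpow_ne_zero _ hψ')
  have hσc : σ.hom c = σ.hom b ^ (q.den : ℤ) * functionFieldMap f ψ ^ (-q.num) := by
    rw [← σ.hom_functionFieldMap ψ]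
    exact (map_mul σ.hom.hom _ _).trans
      (congrArg₂ _ (map_zpow₀ σ.hom.hom _ _) (map_zpow₀ σ.hom.hom _ _))
  have hσc0 : σ.hom c ≠ 0 := (map_ne_zero σ.hom.hom).mpr hc0
  have hint := isIntegralElem_of_forall_mem_stalk f y c (fun x' hx' => by
    rw [← ord_nonneg_iff x' (hcoeff x' hx').1 c hc0, hord x' b hx' hb0]
    have h1 := hb x' hx' (hcoeff x' hx').1 hb0
    rw [(hcoeff x' hx').2] at h1
    have h2 : (0 : ℝ) ≤ (ramificationIndex f x' : ℝ) := Nat.cast_nonneg _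
    have h3 : (q : ℝ) * ramificationIndex f x' ≤ Scheme.ord b x' := by nlinarith
    have h4 : (q.num * ramificationIndex f x' : ℝ) ≤ q.den * Scheme.ord b x' := by
      rw [← hqd]; nlinarith
    have h5 : q.num * (ramificationIndex f x' : ℤ) ≤ q.den * Scheme.ord b x' := by
      exact_mod_cast h4
    linarith) ⟨x, hxy⟩
  have hmem : σ.hom c ∈ (algebraMap (X.presheaf.stalk x) X.functionField).range := by
    subst hxy
    obtain ⟨P, hP, hP0⟩ := hint
    have := IsNormalScheme.isIntegrallyClosed_stalk x
    -- Since `σ` fixes `K(Y)`, the integral equation of `c` over `𝒪_{Y,y}` is also one for `σ c`,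
    -- now read with coefficients in the normal ring `𝒪_{X,x}`.
    have hj : σ.hom.hom.comp ((functionFieldMap f).hom.comp
        (algebraMap (Y.presheaf.stalk (f x)) Y.functionField)) =
        (algebraMap (X.presheaf.stalk x) X.functionField).comp (f.stalkMap x).hom := by
      ext a
      exact (σ.hom_functionFieldMap _).trans (functionFieldMap_algebraMap f x a)
    have hint' : IsIntegral (X.presheaf.stalk x) (σ.hom c) := by
      refine ⟨P.map (f.stalkMap x).hom, hP.map _, ?_⟩
      rw [Polynomial.eval₂_map, ← hj]
      refine (Polynomial.hom_eval₂ P _ σ.hom.hom c).symm.trans ?_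
      rw [hP0, map_zero]
    obtain ⟨r, hr⟩ := IsIntegrallyClosed.isIntegral_iff.mp hint'
    exact ⟨r, hr⟩
  have h := (ord_nonneg_iff x hx _ hσc0).mpr hmem
  rw [hσc, hord x _ hxy hσb] at h
  have h' : (q.num * ramificationIndex f x : ℝ) ≤ q.den * Scheme.ord (σ.hom b) x := by
    exact_mod_cast sub_nonneg.mp h
  rw [← hqd] at h'
  nlinarith

/-- The pullback of functions reflects the filtrations. -/
theorem mem_filtration_of_functionFieldMap_mem (D : RDivisor Y) (x : X)
    (m : ℕ) (b : Y.functionField)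
    (hb : functionFieldMap f b ∈ ((D.pullback f).filtration x).C m) :
    b ∈ (D.filtration (f x)).C m := by
  intro hy hb0
  have hx := coheight_of_coheight_image f x hy
  have h := hb hx ((map_ne_zero (functionFieldMap f).hom).mpr hb0)
  have hD : (D.pullback f).coeff x = (ramificationIndex f x : ℝ) * D.coeff (f x) := if_pos hx
  rw [ord_functionFieldMap f x hx hy b hb0, hD] at h
  push_cast at h
  have hpos : (0 : ℝ) < ramificationIndex f x :=
    Nat.cast_pos.mpr (ramificationIndex_pos f x hx hy)
  refine nonneg_of_mul_nonneg_right ?_ hpos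
  linarith

end Stability

/-! ### From averages of Witt vectors to a retraction of sheaves of modules -/

section Retraction

variable {X Y : Scheme.{u}} [IsIntegral X] [IsIntegral Y] (f : X ⟶ Y) [IsDominant f]
variable {W : CommRingCat.{u} ⥤ CommRingCat.{u}}

theorem HasComponents.map_injective (hW : HasComponents W) {R S : CommRingCat.{u}} (g : R ⟶ S)
    (hg : Function.Injective g) : Function.Injective (W.map g) := by
  obtain ⟨J, c, hc⟩ := hW
  intro a b hab
  apply (c R).injective
  funext j
  apply hg
  rw [← hc, ← hc, hab]

/-- Open subsets of an irreducible space are preconnected, so locally constant functions on them are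
constant. -/
theorem PointwiseSubmodule.sections_eq {M : PointwiseSubmodule W X} {U : X.Opens}
    (φ : M.sections U) (x x' : U) : φ.1 x = φ.1 x' :=
  φ.2.1.apply_eq_of_isPreconnected
    (Subtype.preconnectedSpace
      (IsPreirreducible.open_subset (PreirreducibleSpace.isPreirreducible_univ (X := X))
        U.isOpen (Set.subset_univ _)).isPreconnected).isPreconnected_univ trivial trivial

/-- The sum of the conjugates of a Witt vector over `K(X)`. -/
def galoisSum (W : CommRingCat.{u} ⥤ CommRingCat.{u}) (Φ : W.obj X.functionField) :
    W.obj X.functionField :=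
  ∑ᶠ σ : GaloisGroup f, W.map σ.hom Φ

theorem galoisSum_add [Finite (GaloisGroup f)] (Φ Φ' : W.obj X.functionField) :
    galoisSum f W (Φ + Φ') = galoisSum f W Φ + galoisSum f W Φ' := by
  simp only [galoisSum, map_add]
  exact finsum_add_distrib (Set.toFinite _) (Set.toFinite _)

theorem map_hom_map_functionFieldMap (σ : GaloisGroup f) (a : W.obj Y.functionField) :
    W.map σ.hom (W.map (functionFieldMap f) a) = W.map (functionFieldMap f) a := by
  rw [← ConcreteCategory.comp_apply, ← W.map_comp]
  congr 3
  ext b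
  exact σ.hom_functionFieldMap b

theorem galoisSum_mul [Finite (GaloisGroup f)] (a : W.obj Y.functionField)
    (Φ : W.obj X.functionField) :
    galoisSum f W (W.map (functionFieldMap f) a * Φ) =
      W.map (functionFieldMap f) a * galoisSum f W Φ := by
  simp only [galoisSum, map_mul, map_hom_map_functionFieldMap]
  have := Fintype.ofFinite (GaloisGroup f)
  rw [finsum_eq_sum_of_fintype, finsum_eq_sum_of_fintype, Finset.mul_sum]

theorem galoisSum_map [Finite (GaloisGroup f)] (a : W.obj Y.functionField) :
    galoisSum f W (W.map (functionFieldMap f) a) =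
      Nat.card (GaloisGroup f) • W.map (functionFieldMap f) a := by
  have := Fintype.ofFinite (GaloisGroup f)
  simp only [galoisSum, map_hom_map_functionFieldMap, finsum_eq_sum_of_fintype, Finset.sum_const,
    Finset.card_univ, Nat.card_eq_fintype_card]

variable [Surjective f]

/-- Common to `W` and `W_n`. By `hcard` and surjectivity of `f`, the average of a section is
determined by its defining equation. Additivity, linearity, compatibility with restriction and the
splitting identity all follow from this uniqueness, so the choice of averages does no harm. -/
theorem exists_splitMono_isGaloisAverage [Finite (GaloisGroup f)] (hW : HasComponents W)
    (N : PointwiseSubmodule W Y) (M : PointwiseSubmodule W X)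
    (h : ∀ (x : X), ∀ s ∈ N.S (f x), W.map (functionFieldMap f) s ∈ M.S x)
    (hcard : ∀ a b : W.obj X.functionField,
      Nat.card (GaloisGroup f) • a = Nat.card (GaloisGroup f) • b → a = b)
    (H : ∀ (V : Y.Opens) (Φ : W.obj X.functionField), (∀ x : (f ⁻¹ᵁ V : X.Opens), Φ ∈ M.S x) →
      ∃ Ψ : W.obj Y.functionField, (∀ y : V, Ψ ∈ N.S y) ∧
        Nat.card (GaloisGroup f) • W.map (functionFieldMap f) Ψ = galoisSum f W Φ) :
    ∃ s : SplitMono (N.pullbackHom hW M f h),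
      PointwiseSubmodule.IsGaloisAverage f hW M N s.retraction := by
  have hinj : Function.Injective (W.map (functionFieldMap f)) :=
    hW.map_injective _ (functionFieldMap f).hom.injective
  have huniq : ∀ a b : W.obj Y.functionField,
      Nat.card (GaloisGroup f) • W.map (functionFieldMap f) a =
        Nat.card (GaloisGroup f) • W.map (functionFieldMap f) b → a = b :=
    fun a b hab => hinj (hcard _ _ hab)
  have havg : ∀ (V : Y.Opens) (φ : M.sections (f ⁻¹ᵁ V)), ∃ Ψ : N.sections V,
      ∀ x : (f ⁻¹ᵁ V : X.Opens), Nat.card (GaloisGroup f) •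
        W.map (functionFieldMap f) (Ψ.1 ⟨f x.1, x.2⟩) = galoisSum f W (φ.1 x) := by
    intro V φ
    by_cases hne : Nonempty (f ⁻¹ᵁ V : X.Opens)
    · obtain ⟨x₀⟩ := hne
      obtain ⟨Ψ, hΨ, hΨ'⟩ := H V (φ.1 x₀) fun x => PointwiseSubmodule.sections_eq φ x x₀ ▸ φ.2.2 x
      exact ⟨⟨fun _ => Ψ, IsLocallyConstant.const Ψ, hΨ⟩, fun x => by
        rw [PointwiseSubmodule.sections_eq φ x x₀]; exact hΨ'⟩
    -- Over an empty preimage the required equation is vacuous.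
    · exact ⟨0, fun x => (hne ⟨x⟩).elim⟩
  choose T hT using havg
  have hTuniq : ∀ (V : Y.Opens) (φ : M.sections (f ⁻¹ᵁ V)) (Ψ : N.sections V),
      (∀ x : (f ⁻¹ᵁ V : X.Opens), Nat.card (GaloisGroup f) •
        W.map (functionFieldMap f) (Ψ.1 ⟨f x.1, x.2⟩) = galoisSum f W (φ.1 x)) → T V φ = Ψ := by
    intro V φ Ψ hΨ
    refine Subtype.ext (funext fun y => ?_)
    obtain ⟨y, hy⟩ := y
    obtain ⟨x, rfl⟩ := f.surjective y
    exact huniq _ _ ((hT V φ ⟨x, hy⟩).trans (hΨ ⟨x, hy⟩).symm)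
  have hadd : ∀ (V : Y.Opens) (φ φ' : M.sections (f ⁻¹ᵁ V)),
      T V (φ + φ') = T V φ + T V φ' := fun V φ φ' => hTuniq _ _ _ fun x => by
    have e1 : (φ + φ').1 x = φ.1 x + φ'.1 x := rfl
    have e2 : ∀ y, (T V φ + T V φ').1 y = (T V φ).1 y + (T V φ').1 y := fun _ => rfl
    rw [e1, e2, galoisSum_add, map_add, smul_add, hT, hT]
  have hsmul : ∀ (V : Y.Opens) (a : W.obj Γ(Y, V)) (φ : M.sections (f ⁻¹ᵁ V)),
      T V (W.map (f.app V) a • φ) = a • T V φ := fun V a φ => hTuniq _ _ _ fun x => by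
    have e1 : (W.map (f.app V) a • φ).1 x =
        W.map (functionFieldMap f) (W.map (toFunctionField (⟨f x.1, x.2⟩ : V)) a) * φ.1 x := by
      refine congrArg (· * φ.1 x) ?_
      rw [← ConcreteCategory.comp_apply, ← W.map_comp, ← ConcreteCategory.comp_apply, ← W.map_comp]
      congr 3
      ext b
      exact (functionFieldMap_toFunctionField f x b).symm
    have e2 : ∀ y : V, (a • T V φ).1 y = W.map (toFunctionField y) a * (T V φ).1 y := fun _ => rfl
    rw [e1, e2, galoisSum_mul, map_mul, ← mul_smul_comm, hT]
  let r : M.pushforward hW f ⟶ N.sheaf hW :=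
    { val :=
      { app := fun V => ModuleCat.ofHom (R := (ringSheaf hW Y).obj.obj V)
          (X := (M.pushforward hW f).val.obj V) (Y := (N.sheaf hW).val.obj V)
          { toFun := fun φ => T V.unop φ
            map_add' := fun φ ψ => hadd V.unop φ ψ
            map_smul' := fun a φ => hsmul V.unop a φ }
        naturality := fun {V V'} i => by
          ext φ
          refine hTuniq V'.unop _ (N.restrict i.unop.le (T V.unop φ)) fun x => ?_
          exact hT V.unop φ ⟨x.1, i.unop.le x.2⟩ } }
  refine ⟨⟨r, ?_⟩, ?_⟩
  · apply SheafOfModules.hom_ext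
    ext V φ
    exact hTuniq V.unop _ φ fun x => (galoisSum_map f _).symm
  · rintro V φ _ rfl x
    exact hT V φ x

end Retraction

/-! ### Existence of the average, for full and truncated Witt vectors -/

section Average

variable (p : ℕ) [Fact p.Prime]

/-- A Witt vector over a field is a unit once its zeroth component is nonzero, and that component of
`n` is `n mod p`. -/
theorem exists_wittVector_mul_natCast_eq_one {n : ℕ} (hn : ¬ p ∣ n) :
    ∃ c : WittVector p (ZMod p), c * n = 1 := by
  have h : IsUnit (n : WittVector p (ZMod p)) := by
    refine WittVector.isUnit_of_coeff_zero_ne_zero _ ?_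
    change WittVector.constantCoeff (n : WittVector p (ZMod p)) ≠ 0
    rwa [map_natCast, Ne, ZMod.natCast_eq_zero_iff]
  obtain ⟨u, hu⟩ := h
  exact ⟨(u⁻¹ : (WittVector p (ZMod p))ˣ), by rw [← hu, Units.inv_mul]⟩

/-- Every element of `𝔽_p` is a multiple of `1`. Hence multiplication by Witt vectors from `W(𝔽_p)`,
in particular by `1/|G|`, preserves the divisor conditions. -/
theorem MulFiltration.ringHom_zmod_mem {K : Type*} [CommRing K] (F : MulFiltration K)
    (j : ZMod p →+* K) (a : ZMod p) : j a ∈ F.C 0 := by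
  rw [← ZMod.natCast_zmod_val a, map_natCast, ← nsmul_one]
  exact nsmul_mem F.one_mem _

theorem IsFpScheme.exists_ringHom {Y : Scheme.{u}} [IsIntegral Y] (hY : IsFpScheme p Y) :
    Nonempty (ZMod p →+* Y.functionField) := by
  obtain ⟨g⟩ := hY
  have : Nonempty (⊤ : Y.Opens) := ⟨⟨genericPoint Y, trivial⟩⟩
  exact ⟨((Y.germToFunctionField ⊤).hom.comp ((Scheme.ΓSpecIso _).inv ≫ g.appTop).hom).comp
    (ULift.ringEquiv (R := ZMod p)).symm.toRingHom⟩

variable {X Y : Scheme.{u}} [IsIntegral X] [IsIntegral Y] {f : X ⟶ Y} [IsDominant f]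

theorem exists_functionFieldMap_eq (hGal : IsGaloisExtension f) (b : X.functionField)
    (hb : ∀ σ : GaloisGroup f, σ.hom b = b) : ∃ a, functionFieldMap f a = b := by
  let := functionFieldAlgebra f
  have : IsGalois Y.functionField X.functionField := hGal
  exact (InfiniteGalois.mem_range_algebraMap_iff_fixed b).mpr hb

theorem GaloisGroup.exists_perm_hom_eq_comp (τ : GaloisGroup f) :
    ∃ e : Equiv.Perm (GaloisGroup f), ∀ σ, (e σ).hom = σ.hom ≫ τ.hom := by
  let := functionFieldAlgebra f
  exact ⟨Equiv.mulLeft (G := X.functionField ≃ₐ[Y.functionField] X.functionField) τ,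
    fun σ => rfl⟩

/-- Left translation by `τ` permutes the summands. -/
theorem map_hom_galoisSum {W : CommRingCat.{u} ⥤ CommRingCat.{u}} [Finite (GaloisGroup f)]
    (τ : GaloisGroup f) (Φ : W.obj X.functionField) :
    W.map τ.hom (galoisSum f W Φ) = galoisSum f W Φ := by
  have := Fintype.ofFinite (GaloisGroup f)
  obtain ⟨e, he⟩ := τ.exists_perm_hom_eq_comp
  rw [galoisSum, finsum_eq_sum_of_fintype, map_sum]
  refine Eq.trans (Finset.sum_congr rfl fun σ _ => ?_)
    (Equiv.sum_comp e fun σ : GaloisGroup f => W.map σ.hom Φ)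
  rw [← ConcreteCategory.comp_apply, ← W.map_comp, he]

theorem galoisSum_wittFunctor [Fintype (GaloisGroup f)] (Φ : WittVector p X.functionField) :
    galoisSum f (wittFunctor p) Φ = ∑ σ : GaloisGroup f, WittVector.map σ.hom.hom Φ :=
  finsum_eq_sum_of_fintype _

theorem galoisSum_truncWittFunctor [Fintype (GaloisGroup f)] (n : ℕ)
    (Φ : TruncatedWittVector p n X.functionField) :
    galoisSum f (truncWittFunctor p n) Φ = ∑ σ : GaloisGroup f, truncMap p n σ.hom.hom Φ :=
  finsum_eq_sum_of_fintype _

variable [IsLocallyNoetherian X] [IsNormalScheme X] [IsLocallyNoetherian Y] [IsNormalScheme Y]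
  [IsFinite f]

theorem galoisSum_mem_witt [Finite (GaloisGroup f)] (D : RDivisor Y) (y : Y)
    (Φ : WittVector p X.functionField)
    (hΦ : ∀ x, f x = y → Φ ∈ ((D.pullback f).filtration x).witt p) (x : X) (hx : f x = y) :
    galoisSum f (wittFunctor p) Φ ∈ ((D.pullback f).filtration x).witt p := by
  have := Fintype.ofFinite (GaloisGroup f)
  rw [galoisSum_wittFunctor]
  refine sum_mem fun σ _ m => ?_
  rw [WittVector.map_coeff]
  by_cases hy : Order.coheight y = 1
  · exact filtration_pullback_galois_stable D σ y hy _ _ (fun x' hx' => hΦ x' hx' m) x hx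
  -- If `y` is not of codimension one, neither is `x`, and no condition is imposed there.
  · exact fun hx1 => absurd (hx ▸ coheight_image f x hx1) hy

theorem exists_witt_average [Surjective f] (hY : IsFpScheme p Y)
    (hGal : IsGaloisExtension f) (hG : ¬ p ∣ Nat.card (GaloisGroup f)) [Finite (GaloisGroup f)]
    (D : RDivisor Y) (V : Y.Opens) (Φ : WittVector p X.functionField)
    (hΦ : ∀ x : (f ⁻¹ᵁ V : X.Opens), Φ ∈ ((D.pullback f).filtration x.1).witt p) :
    ∃ Ψ : WittVector p Y.functionField, (∀ y : V, Ψ ∈ (D.filtration y.1).witt p) ∧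
      Nat.card (GaloisGroup f) • WittVector.map (functionFieldMap f).hom Ψ =
        galoisSum f (wittFunctor p) Φ := by
  obtain ⟨c, hc⟩ := exists_wittVector_mul_natCast_eq_one p hG
  obtain ⟨j⟩ := hY.exists_ringHom
  set S : WittVector p X.functionField := galoisSum f (wittFunctor p) Φ
  have hfix : ∀ m, ∃ a, functionFieldMap f a = S.coeff m := fun m =>
    exists_functionFieldMap_eq hGal _ fun σ =>
      (WittVector.map_coeff σ.hom.hom S m).symm.trans
        (congrArg (fun s : WittVector p X.functionField => s.coeff m)
          (map_hom_galoisSum (W := wittFunctor p) σ Φ))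
  choose a ha using hfix
  have hΨ₀ : WittVector.map (functionFieldMap f).hom (WittVector.mk p a) = S :=
    WittVector.ext fun m => (WittVector.map_coeff _ _ m).trans (ha m)
  -- Here `c` is the inverse of `|G|` in `W(𝔽_p)`, and `WittVector.mk p a` is the descent of the sum
  -- of conjugates.
  refine ⟨WittVector.map j c * WittVector.mk p a, ?_, ?_⟩
  · rintro ⟨y, hy⟩ m
    obtain ⟨x, rfl⟩ := f.surjective y
    have hSx : S ∈ ((D.pullback f).filtration x).witt p :=
      galoisSum_mem_witt p D (f x) Φ (fun x' hx' => hΦ ⟨x', show f x' ∈ V from hx' ▸ hy⟩) x rfl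
    refine mem_filtration_of_functionFieldMap_mem D x _ _ ?_
    have h := ((D.pullback f).filtration x).mul_mem_witt p
      (a := WittVector.map (functionFieldMap f).hom (WittVector.map j c)) (fun n => by
        rw [WittVector.map_coeff, WittVector.map_coeff]
        exact MulFiltration.ringHom_zmod_mem p _ ((functionFieldMap f).hom.comp j) _) hSx m
    rwa [← hΨ₀, ← map_mul, WittVector.map_coeff] at h
  · rw [← map_nsmul, nsmul_eq_mul, ← mul_assoc, ← map_natCast (WittVector.map j), ← map_mul,
      mul_comm _ c, hc, map_one, one_mul, hΨ₀]

theorem exists_truncWitt_average [Surjective f] (hY : IsFpScheme p Y)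
    (hGal : IsGaloisExtension f) (hG : ¬ p ∣ Nat.card (GaloisGroup f)) [Finite (GaloisGroup f)]
    (D : RDivisor Y) (V : Y.Opens) (n : ℕ) (Φ : TruncatedWittVector p n X.functionField)
    (hΦ : ∀ x : (f ⁻¹ᵁ V : X.Opens), Φ ∈ ((D.pullback f).filtration x.1).truncWitt p n) :
    ∃ Ψ : TruncatedWittVector p n Y.functionField, (∀ y : V, Ψ ∈ (D.filtration y.1).truncWitt p n) ∧
      Nat.card (GaloisGroup f) • truncMap p n (functionFieldMap f).hom Ψ =
        galoisSum f (truncWittFunctor p n) Φ := by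
  have htrunc : ∀ {R S : CommRingCat.{u}} (g : R ⟶ S) (x : WittVector p R),
      truncMap p n g.hom (WittVector.truncate n x) =
        WittVector.truncate n (WittVector.map g.hom x) := fun g x =>
    TruncatedWittVector.ext fun i => by
      rw [truncMap_coeff, WittVector.coeff_truncate, WittVector.coeff_truncate,
        WittVector.map_coeff]
  -- `Φ.out` pads `Φ` with zeros, which satisfy every divisor condition.
  obtain ⟨Ψ, hΨ, hsum⟩ := exists_witt_average p hY hGal hG D V Φ.out fun x m => by
    simp only [TruncatedWittVector.out]
    split_ifs with hm
    · exact hΦ x ⟨m, hm⟩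
    · exact zero_mem _
  have hΦ' : WittVector.truncate n Φ.out = Φ := TruncatedWittVector.truncateFun_out Φ
  refine ⟨WittVector.truncate n Ψ, fun y i => ?_, ?_⟩
  · rw [WittVector.coeff_truncate]
    exact hΨ y i
  · have := Fintype.ofFinite (GaloisGroup f)
    rw [htrunc, ← map_nsmul, hsum, galoisSum_wittFunctor, galoisSum_truncWittFunctor, map_sum]
    refine Finset.sum_congr rfl fun σ _ => ?_
    exact (htrunc σ.hom Φ.out).symm.trans (congrArg (truncMap p n σ.hom.hom) hΦ')

end Average

end

end WittDiv


theorem mainTheorem3 (p : ℕ) [Fact p.Prime] {X Y : AlgebraicGeometry.Scheme.{u}}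
    [AlgebraicGeometry.IsIntegral X] [AlgebraicGeometry.IsIntegral Y]
    [AlgebraicGeometry.IsLocallyNoetherian X] [AlgebraicGeometry.IsLocallyNoetherian Y]
    [WittDiv.IsNormalScheme X] [WittDiv.IsNormalScheme Y] (hY : WittDiv.IsFpScheme p Y)
    (f : X ⟶ Y) [AlgebraicGeometry.IsFinite f] [AlgebraicGeometry.Surjective f]
    (hGal : WittDiv.IsGaloisExtension f) (hG : ¬ p ∣ Nat.card (WittDiv.GaloisGroup f))
    (D : WittDiv.RDivisor Y) :
    (∀ n : ℕ, 1 ≤ n → ∃ s : CategoryTheory.SplitMono (D.truncWittPullback p n f),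
      WittDiv.PointwiseSubmodule.IsGaloisAverage f (WittDiv.truncWittFunctor_hasComponents p n)
        ((D.pullback f).truncWittSubmodule p n) (D.truncWittSubmodule p n) s.retraction) ∧
    (∃ s : CategoryTheory.SplitMono (D.wittPullback p f),
      WittDiv.PointwiseSubmodule.IsGaloisAverage f (WittDiv.wittFunctor_hasComponents p)
        ((D.pullback f).wittSubmodule p) (D.wittSubmodule p) s.retraction) := by
  have : Finite (WittDiv.GaloisGroup f) :=
    Nat.finite_of_card_ne_zero fun h => hG (h ▸ dvd_zero p)
  obtain ⟨c, hc⟩ := WittDiv.exists_wittVector_mul_natCast_eq_one p hG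
  obtain ⟨j⟩ := hY.exists_ringHom
  -- Any ring receiving a homomorphism from `W(𝔽_p)` has `|G|` invertible; this serves both
  -- `W(K(X))` and `W_n(K(X))`.
  have hcard : ∀ {R : Type u} [CommRing R], (WittVector p (ZMod p) →+* R) → ∀ a b : R,
      Nat.card (WittDiv.GaloisGroup f) • a = Nat.card (WittDiv.GaloisGroup f) • b → a = b := by
    intro R _ g a b hab
    rw [nsmul_eq_mul, nsmul_eq_mul] at hab
    have h := congrArg (g c * ·) hab
    simpa only [← mul_assoc, ← map_natCast g, ← map_mul, hc, map_one, one_mul] using h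
  have g : WittVector p (ZMod p) →+* WittVector p X.functionField :=
    WittVector.map ((WittDiv.functionFieldMap f).hom.comp j)
  refine ⟨fun n _ => ?_, ?_⟩
  · exact WittDiv.exists_splitMono_isGaloisAverage f (WittDiv.truncWittFunctor_hasComponents p n)
      (D.truncWittSubmodule p n) ((D.pullback f).truncWittSubmodule p n) _
      (hcard (R := TruncatedWittVector p n X.functionField) ((WittVector.truncate n).comp g))
      fun V Φ hΦ => WittDiv.exists_truncWitt_average p hY hGal hG D V n Φ hΦ
  · exact WittDiv.exists_splitMono_isGaloisAverage f (WittDiv.wittFunctor_hasComponents p)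
      (D.wittSubmodule p) ((D.pullback f).wittSubmodule p) _
      (hcard (R := WittVector p X.functionField) g)
      fun V Φ hΦ => WittDiv.exists_witt_average p hY hGal hG D V Φ hΦ
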